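/- Let $H$ be a nontrivial group, let $d\ge 1$, and let $G=H\wr\mathbb Z^d$ be the lamplighter group: the pairs $(f,y)$ with $y\in\mathbb Z^d$ and $f:\mathbb Z^d\to H$ equal to the identity at all but finitely many points, with $(f,y)(g,z)=(f\cdot g(\,\cdot-y),\,y+z)$. For a probability measure $\mu$ on $G$, the walk generated by $\mu$ is $\xi_0=e$, $\xi_n=s_1s_2\cdots s_n$ with $s_1,s_2,\dots$ independent of law $\mu$; a set $S\subseteq G$ is $\mu$-recurrent if almost surely $\xi_n\in S$ for infinitely many $n$, and $\mu$-transient if almost surely $\xi_n\in S$ for only finitely many $n$; Green's function is $G_\mu(x,y)=\sum_{n\ge 0}\mu^{*n}(x^{-1}y)$. Then $G$ admits instability of recurrence and of Green's function. That is, there are symmetric, finitely supported probability measures $\mu$ and $\nu$ on $G$, whose supports generate the same subgroup of $G$, and this subgroup is all of $G$ if $H$ is finitely generated, such that (1) some set $S\subseteq G$ is $\nu$-recurrent but $\mu$-transient, and (2) there is a sequence $(x_n)$ in $G$ such that $G_\mu(e,x_n)$ and $G_\nu(e,x_n)$ are positive and finite for all $n$ and $G_\mu(e,x_n)/G_\nu(e,x_n)\to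 0$. -/

import Mathlib

open Filter Topology MeasureTheory

/-- The restricted wreath product `H ≀ Q`: pairs `(f, y)` with `y : Q` and `f : Q → H` equal to the
identity at all but finitely many points, with the law
`(f, y) (g, z) = (x ↦ f x * g (y⁻¹ * x), y * z)`. It is the subgroup of finitely supported lamp
configurations in Mathlib's (unrestricted) regular wreath product. -/
def restrictedWreathProduct (H Q : Type*) [Group H] [Group Q] :
    Subgroup (RegularWreathProduct H Q) where
  carrier := {g | (Function.mulSupport g.left).Finite}
  one_mem' := by simp
  mul_mem' := by
    intro a b ha hb
    refine (ha.union (hb.image fun x => a.right * x)).subset ?_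
    intro x hx
    by_contra h
    simp only [Set.mem_union, Function.mem_mulSupport, not_or, not_not, Set.mem_image,
      not_exists, not_and] at h
    refine hx ?_
    have h2 : b.left (a.right⁻¹ * x) = 1 := by
      by_contra h3
      exact h.2 _ h3 (by simp)
    simp [h.1, h2]
  inv_mem' := by
    intro a ha
    refine (ha.image fun x => a.right⁻¹ * x).subset ?_
    intro x hx
    refine ⟨a.right * x, ?_, by simp⟩
    simpa using hx

/-- The lamplighter group `H ≀ ℤ^d`. -/
abbrev LamplighterGroup (H : Type*) [Group H] (d : ℕ) : Type _ :=
  restrictedWreathProduct H (Multiplicative (Fin d → ℤ))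

namespace RandomWalk

variable {G : Type*} [Group G]

/-- The measure `μ` is symmetric: `μ(g⁻¹) = μ(g)`. -/
def IsSymmetric (μ : PMF G) : Prop := ∀ g, μ g⁻¹ = μ g

/-- The position at time `n` of the walk started at the identity with increments `ω 0, ω 1, …`:
the product `ω 0 * ω 1 * ⋯ * ω (n - 1)`. -/
def position (ω : ℕ → G) : ℕ → G
  | 0 => 1
  | n + 1 => position ω n * ω n

/-- `S` is `μ`-recurrent: the walk with independent `μ`-distributed increments, started at the
identity, almost surely visits `S` infinitely often. -/
def IsRecurrentSet (μ : PMF G) (S : Set G) : Prop :=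
  letI : MeasurableSpace G := ⊤
  ∀ᵐ ω ∂(Measure.infinitePi fun _ : ℕ => μ.toMeasure), ∃ᶠ n in atTop, position ω n ∈ S

/-- `S` is `μ`-transient: the walk with independent `μ`-distributed increments, started at the
identity, almost surely visits `S` only finitely often. -/
def IsTransientSet (μ : PMF G) (S : Set G) : Prop :=
  letI : MeasurableSpace G := ⊤
  ∀ᵐ ω ∂(Measure.infinitePi fun _ : ℕ => μ.toMeasure), ∀ᶠ n in atTop, position ω n ∉ S

/-- The `n`-th convolution power of `μ`, that is, the law at time `n` of the walk generated by `μ`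
and started at the identity. -/
noncomputable def convPow (μ : PMF G) : ℕ → PMF G
  | 0 => PMF.pure 1
  | n + 1 => (convPow μ n).bind fun g => μ.map fun h => g * h

/-- Green's function `G_μ(x, y) = ∑ₙ p_n(x, y)`, where `p_n(x, y) = μ^{*n}(x⁻¹ y)`: the expected
number of visits to `y` of the walk started at `x`. -/
noncomputable def green (μ : PMF G) (x y : G) : ENNReal := ∑' n, convPow μ n (x⁻¹ * y)

/-- Some set is recurrent for `ν` but transient for `μ`. -/
def RecurrenceUnstable (μ ν : PMF G) : Prop :=
  ∃ S : Set G, IsRecurrentSet ν S ∧ IsTransientSet μ S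

/-- `G_μ(e, xₙ) / G_ν(e, xₙ) → 0` along some sequence at which all these values of Green's
functions are positive and finite. -/
def GreenUnstable (μ ν : PMF G) : Prop :=
  ∃ x : ℕ → G,
    (∀ n, 0 < green μ 1 (x n) ∧ green μ 1 (x n) < ⊤ ∧
      0 < green ν 1 (x n) ∧ green ν 1 (x n) < ⊤) ∧
    Tendsto (fun n => green μ 1 (x n) / green ν 1 (x n)) atTop (𝓝 0)

end RandomWalk

set_option linter.unusedSectionVars false

/-! Measure height in ℤ^d by one coordinate, and let t be the unit vector in that direction. Both
walks are switch-walk-switch walks with the same support, differing only in a parameter ε: a lamp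
switch is trivial except with probability ε, and a step is a fair step by t or its inverse except
with probability ε. What is compared is how often they visit `clearedSet a m`, where the lamplighter
is at height m and every lamp above height a is off.

Upper bound. On reaching a new record height above a, the walk meets an untouched lamp, and the
switch made on arrival is independent of all other choices. Given those choices, at most one value
of this switch leads to a prescribed configuration, so each record costs a factor c, a bound on the
atoms of the switch law (`wordExp_lamps_le`). The height is a symmetric walk with steps at most 1,
so it visits m only O(i + 1) times on average before exceeding m + i. Summing over i bounds the
expected number of visits by a constant times c^(m - a) (`exists_tsum_clearedSet_le`). Here c = 1 -
ε for ε ≤ 1/2.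

Lower bound. Each pure move by t or its inverse has probability at least b = (1 - ε)^3 / 2. If θ ≤ b
(1 + θ²), then θ^distance is subharmonic along the line of powers of t away from its base point, so
Green's function at t^n is at least θ^n (`pow_le_green`). For small ε, θ may be taken near 1.

With ε = 1/2 for μ and ε = 1/100 for ν, c = 1/2 competes with θ = 3/4. Hence the Green ratio along
t^n is O((2/3)^n). For recurrence, choose heights A j with gaps 2 log₂(j + 2) and let S be the union
of the sets `clearedSet (A j) (A (j + 1))`. The sum of c^gap converges, so S is μ-transient by
Borel–Cantelli. The sum of θ^gap diverges, and θ^gap bounds below the chance of success between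
consecutive records A j, whatever happened before, so S is ν-recurrent. The last argument uses no
stopping times: the avoidance probability is subharmonic and is controlled by a maximum principle on
half-spaces. -/

namespace RandomWalk

variable {G : Type*} [Group G]

/-! ### Expectations over words; criteria for transience and recurrence -/

/-- The expectation of `F` over words of `n` independent `μ`-distributed letters, the latest letter
at the head of the list. -/
noncomputable def wordExp (μ : PMF G) : ℕ → (List G → ENNReal) → ENNReal
  | 0, F => F []
  | n + 1, F => wordExp μ n fun l => ∑' g, μ g * F (g :: l)

/-- The group element spelled by a word with the latest letter at the head. -/
def wordProd : List G → G
  | [] => 1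
  | g :: l => wordProd l * g

/-- The first `n` increments, latest first. -/
def history (ω : ℕ → G) : ℕ → List G
  | 0 => []
  | n + 1 => ω n :: history ω n

theorem wordProd_history (ω : ℕ → G) (n : ℕ) : wordProd (history ω n) = position ω n := by
  induction n with
  | zero => rfl
  | succ n ih => simp [history, wordProd, position, ih]

section wordExp

variable (μ : PMF G)

theorem wordExp_mono {n : ℕ} {F F' : List G → ENNReal} (h : ∀ l, F l ≤ F' l) :
    wordExp μ n F ≤ wordExp μ n F' := by
  induction n generalizing F F' with
  | zero => exact h []
  | succ n ih => exact ih fun l => ENNReal.tsum_le_tsum fun g => mul_le_mul_right (h _) _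

/-- Words with a letter off the support carry no mass, so a comparison may use any invariant `p` of
the remaining words. -/
theorem wordExp_mono_of_support {p : List G → Prop} (h0 : p [])
    (hp : ∀ g l, p l → g ∈ μ.support → p (g :: l))
    {n : ℕ} {F F' : List G → ENNReal} (h : ∀ l, p l → F l ≤ F' l) :
    wordExp μ n F ≤ wordExp μ n F' := by
  induction n generalizing F F' with
  | zero => exact h [] h0
  | succ n ih =>
    refine ih fun l hl => ENNReal.tsum_le_tsum fun g => ?_
    by_cases hg : μ g = 0
    · simp [hg]
    · exact mul_le_mul_right (h _ (hp g l hl hg)) _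

theorem wordExp_tsum {ι : Type*} (n : ℕ) (F : ι → List G → ENNReal) :
    wordExp μ n (fun l => ∑' i, F i l) = ∑' i, wordExp μ n (F i) := by
  induction n generalizing F with
  | zero => rfl
  | succ n ih =>
    simp only [wordExp]
    rw [← ih]
    congr 1
    ext l
    simp_rw [← ENNReal.tsum_mul_left]
    exact ENNReal.tsum_comm

theorem wordExp_add (n : ℕ) (F F' : List G → ENNReal) :
    wordExp μ n (fun l => F l + F' l) = wordExp μ n F + wordExp μ n F' := by
  induction n generalizing F F' with
  | zero => rfl
  | succ n ih =>
    simp only [wordExp]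
    rw [← ih]
    simp_rw [mul_add, ENNReal.tsum_add]

theorem wordExp_const_mul (n : ℕ) (c : ENNReal) (F : List G → ENNReal) :
    wordExp μ n (fun l => c * F l) = c * wordExp μ n F := by
  induction n generalizing F with
  | zero => rfl
  | succ n ih =>
    simp only [wordExp]
    rw [← ih]
    congr 1
    ext l
    rw [← ENNReal.tsum_mul_left]
    simp_rw [mul_left_comm]

theorem wordExp_sum {ι : Type*} (s : Finset ι) (n : ℕ) (F : ι → List G → ENNReal) :
    wordExp μ n (fun l => ∑ i ∈ s, F i l) = ∑ i ∈ s, wordExp μ n (F i) := by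
  rw [← Finset.tsum_subtype, ← wordExp_tsum]
  congr 1
  ext l
  rw [Finset.tsum_subtype s fun i => F i l]

theorem tsum_convPow_mul (n : ℕ) (φ : G → ENNReal) :
    ∑' g, convPow μ n g * φ g = wordExp μ n fun l => φ (wordProd l) := by
  classical
  induction n generalizing φ with
  | zero =>
    simp only [convPow, wordExp, wordProd, PMF.pure_apply, ite_mul, one_mul, zero_mul]
    exact tsum_ite_eq 1 _
  | succ n ih =>
    simp only [convPow, wordExp, wordProd]
    rw [← ih fun x => ∑' g, μ g * φ (x * g)]
    simp_rw [PMF.bind_apply, ← ENNReal.tsum_mul_right]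
    rw [ENNReal.tsum_comm]
    refine tsum_congr fun x => ?_
    simp_rw [mul_assoc]
    rw [ENNReal.tsum_mul_left]
    congr 1
    rw [← Equiv.tsum_eq (Equiv.mulLeft x)]
    refine tsum_congr fun g => ?_
    congr 1
    rw [PMF.map_apply, tsum_eq_single g]
    · simp
    · intro b hb
      rw [if_neg]
      simpa using fun h => hb h.symm

open Classical in
theorem convPow_apply_eq_wordExp (n : ℕ) (x : G) :
    convPow μ n x = wordExp μ n fun l => if wordProd l = x then 1 else 0 := by
  rw [← tsum_convPow_mul μ n fun g => if g = x then 1 else 0]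
  simp

open Classical in
theorem wordExp_history (ω : ℕ → G) (n : ℕ) :
    wordExp μ n (fun l => if l = history ω n then 1 else 0) = ∏ k ∈ Finset.range n, μ (ω k) := by
  induction n with
  | zero => simp [wordExp, history]
  | succ n ih =>
    rw [Finset.prod_range_succ, ← ih, mul_comm, ← wordExp_const_mul]
    simp only [wordExp, history, List.cons.injEq]
    congr 1
    ext l
    rw [tsum_eq_single (ω n)]
    · simp
    · intro g hg
      simp [hg]

theorem history_eq_iff (ω ω' : ℕ → G) (n : ℕ) :
    history ω n = history ω' n ↔ ∀ k < n, ω k = ω' k := by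
  induction n with
  | zero => simp [history]
  | succ n ih =>
    simp only [history, List.cons.injEq, ih]
    constructor
    · rintro ⟨h, h'⟩ k hk
      rcases Nat.lt_succ_iff_lt_or_eq.1 hk with hk | rfl
      exacts [h' k hk, h]
    · exact fun h => ⟨h n n.lt_succ_self, fun k hk => h k (hk.trans n.lt_succ_self)⟩

theorem finite_range_history (hμ : μ.support.Finite) (n : ℕ) :
    {l | ∃ ω : ℕ → G, (∀ k, ω k ∈ μ.support) ∧ history ω n = l}.Finite := by
  induction n with
  | zero => exact (Set.finite_singleton []).subset (by rintro _ ⟨ω, -, rfl⟩; rfl)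
  | succ n ih =>
    refine (hμ.image2 List.cons ih).subset ?_
    rintro _ ⟨ω, h, rfl⟩
    exact ⟨ω n, h n, history ω n, ⟨ω, h, rfl⟩, rfl⟩

/-- The law of the sequence of increments. -/
noncomputable abbrev incrementMeasure : @Measure (ℕ → G) (@MeasurableSpace.pi _ _ fun _ => ⊤) :=
  letI : MeasurableSpace G := ⊤
  Measure.infinitePi fun _ : ℕ => μ.toMeasure

theorem incrementMeasure_history (ω₀ : ℕ → G) (n : ℕ) :
    incrementMeasure μ {ω | history ω n = history ω₀ n} = ∏ k ∈ Finset.range n, μ (ω₀ k) := by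
  let _ : MeasurableSpace G := ⊤
  have : {ω : ℕ → G | history ω n = history ω₀ n} =
      Set.pi (Finset.range n : Set ℕ) fun k => {ω₀ k} := by
    ext ω
    simp [history_eq_iff]
  rw [this, incrementMeasure, Measure.infinitePi_pi]
  · exact Finset.prod_congr rfl fun k _ =>
      PMF.toMeasure_apply_singleton _ _ (MeasurableSpace.measurableSet_top)
  · exact fun _ _ => MeasurableSpace.measurableSet_top

theorem ae_mem_support : ∀ᵐ ω ∂(incrementMeasure μ), ∀ k, ω k ∈ μ.support := by
  let _ : MeasurableSpace G := ⊤
  rw [ae_all_iff]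
  intro k
  have h : ∀ᵐ g ∂μ.toMeasure, g ∈ μ.support := by
    rw [ae_iff, PMF.toMeasure_apply_eq_zero_iff _ MeasurableSpace.measurableSet_top]
    exact Set.disjoint_left.2 fun g h h' => h' h
  exact (measurePreserving_eval_infinitePi (fun _ : ℕ => μ.toMeasure) k).quasiMeasurePreserving.ae h

-- Finite support leaves finitely many histories up to a null set, so a finite union bound suffices
-- and `A` need not be measurable in any sense.
open Classical in
theorem incrementMeasure_le_wordExp (hμ : μ.support.Finite) (n : ℕ) (A : List G → Prop) :
    incrementMeasure μ {ω | A (history ω n)} ≤ wordExp μ n fun l => if A l then 1 else 0 := by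
  let _ : MeasurableSpace G := ⊤
  set L : Finset (List G) := (finite_range_history μ hμ n).toFinset.filter A
  have h1 : {ω | A (history ω n)} ≤ᵐ[incrementMeasure μ] ⋃ l ∈ L, {ω | history ω n = l} := by
    filter_upwards [ae_mem_support μ] with ω hω h
    refine Set.mem_iUnion₂.2 ⟨history ω n, ?_, rfl⟩
    simp only [L, Finset.mem_filter, Set.Finite.mem_toFinset]
    exact ⟨⟨ω, hω, rfl⟩, h⟩
  calc incrementMeasure μ {ω | A (history ω n)}
      ≤ incrementMeasure μ (⋃ l ∈ L, {ω | history ω n = l}) := measure_mono_ae h1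
    _ ≤ ∑ l ∈ L, incrementMeasure μ {ω | history ω n = l} := measure_biUnion_finset_le _ _
    _ = ∑ l ∈ L, wordExp μ n fun l' => if l' = l then 1 else 0 := by
        refine Finset.sum_congr rfl fun l hl => ?_
        simp only [L, Finset.mem_filter, Set.Finite.mem_toFinset] at hl
        obtain ⟨⟨ω₀, -, rfl⟩, -⟩ := hl
        rw [incrementMeasure_history, wordExp_history]
    _ = wordExp μ n fun l' => ∑ l ∈ L, if l' = l then 1 else 0 := (wordExp_sum μ L n _).symm
    _ ≤ _ := by
        refine wordExp_mono μ fun l => ?_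
        rw [Finset.sum_ite_eq]
        by_cases h : l ∈ L
        · rw [if_pos h, if_pos (Finset.mem_filter.1 h).2]
        · simp [h]

-- First Borel–Cantelli lemma.
open Classical in
theorem isTransientSet_of_tsum_ne_top (hμ : μ.support.Finite) (S : Set G)
    (h : ∑' n, wordExp μ n (fun l => if wordProd l ∈ S then 1 else 0) ≠ ⊤) :
    IsTransientSet μ S := by
  let _ : MeasurableSpace G := ⊤
  have h1 : ∑' n, incrementMeasure μ {ω | position ω n ∈ S} ≠ ⊤ := by
    refine ne_top_of_le_ne_top h (ENNReal.tsum_le_tsum fun n => ?_)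
    simpa only [wordProd_history] using
      incrementMeasure_le_wordExp μ hμ n fun l => wordProd l ∈ S
  exact (ae_eventually_notMem h1 : _)

/-- The one-step operator of the walk killed on `S`. -/
noncomputable def killedStep (S : Set G) (φ : G → ENNReal) : G → ENNReal := by
  classical
  exact fun g => if g ∈ S then 0 else ∑' s, μ s * φ (g * s)

/-- The word avoids `S` at the last `n` times before its end. -/
def Avoids (S : Set G) : ℕ → List G → Prop
  | 0, _ => True
  | _ + 1, [] => True
  | n + 1, _ :: l => Avoids S n l ∧ wordProd l ∉ S

theorem avoids_history_iff (S : Set G) (ω : ℕ → G) (N n : ℕ) :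
    Avoids S n (history ω (N + n)) ↔ ∀ k < n, position ω (N + k) ∉ S := by
  induction n with
  | zero => simp [Avoids]
  | succ n ih =>
    rw [← Nat.add_assoc]
    simp only [history, Avoids, ih, wordProd_history]
    constructor
    · rintro ⟨h, h'⟩ k hk
      rcases Nat.lt_succ_iff_lt_or_eq.1 hk with hk | rfl
      exacts [h k hk, h']
    · exact fun h => ⟨fun k hk => h k (hk.trans n.lt_succ_self), h n n.lt_succ_self⟩

-- Markov property: integrating out the last `n` letters, with `S` forbidden along the way, iterates
-- the killed operator at the position of time `N`.
open Classical in
theorem wordExp_avoids (S : Set G) (N n : ℕ) (φ : G → ENNReal) :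
    wordExp μ (N + n) (fun l => if Avoids S n l then φ (wordProd l) else 0) =
      wordExp μ N fun l => ((killedStep μ S)^[n] φ) (wordProd l) := by
  induction n generalizing φ with
  | zero => simp [Avoids]
  | succ n ih =>
    rw [Function.iterate_succ_apply, ← ih, ← Nat.add_assoc]
    simp only [wordExp, Avoids, wordProd]
    congr 1
    ext l
    by_cases h : Avoids S n l <;> by_cases h' : wordProd l ∈ S <;> simp [h, h', killedStep]

theorem tendsto_wordExp_zero (hμ : μ.support.Finite) (N : ℕ) (F : ℕ → List G → ENNReal)
    (h : ∀ l, Tendsto (fun n => F n l) atTop (𝓝 0)) :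
    Tendsto (fun n => wordExp μ N (F n)) atTop (𝓝 0) := by
  induction N generalizing F with
  | zero => exact h []
  | succ N ih =>
    refine ih _ fun l => ?_
    have h1 : ∀ n, ∑' g, μ g * F n (g :: l) = ∑ g ∈ hμ.toFinset, μ g * F n (g :: l) := fun n =>
      tsum_eq_sum fun g hg => by
        have : μ g = 0 := by simpa using hg
        simp [this]
    simp_rw [h1]
    have : Tendsto (fun n => ∑ g ∈ hμ.toFinset, μ g * F n (g :: l)) atTop
        (𝓝 (∑ g ∈ hμ.toFinset, μ g * 0)) :=
      tendsto_finsetSum _ fun g _ =>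
        ENNReal.Tendsto.const_mul (h _) (Or.inr (PMF.apply_ne_top μ g))
    simpa using this

/-- Avoiding `S` from time `N` on is at most as likely as surviving `n` more steps, averaged over
the finitely many relevant positions at time `N`; let `n` grow, then take the countable union over
`N`. -/
theorem isRecurrentSet_of_tendsto (hμ : μ.support.Finite) (S : Set G)
    (h : ∀ g, Tendsto (fun n => ((killedStep μ S)^[n] fun _ => 1) g) atTop (𝓝 0)) :
    IsRecurrentSet μ S := by
  classical
  let _ : MeasurableSpace G := ⊤
  have key : ∀ᵐ ω ∂(incrementMeasure μ), ∀ N, ¬ ∀ n ≥ N, position ω n ∉ S := by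
    rw [ae_all_iff]
    intro N
    rw [ae_iff]
    simp only [not_not]
    refine le_antisymm (ge_of_tendsto' (tendsto_wordExp_zero μ hμ N
      (fun n l => ((killedStep μ S)^[n] fun _ => 1) (wordProd l)) fun l => h _) fun n => ?_)
      bot_le
    rw [← wordExp_avoids]
    refine le_trans (measure_mono ?_) (incrementMeasure_le_wordExp μ hμ (N + n) (Avoids S n))
    intro ω hω
    exact (avoids_history_iff S ω N n).2 fun k _ => hω _ (Nat.le_add_right _ _)
  change ∀ᵐ ω ∂(incrementMeasure μ), ∃ᶠ n in atTop, position ω n ∈ S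
  filter_upwards [key] with ω hω
  rw [frequently_atTop]
  intro N
  simpa using hω N

end wordExp

end RandomWalk

/-! ### Elements of the wreath product -/

theorem PMF.tsum_bind_mul {α β : Type*} (p : PMF α) (f : α → PMF β) (F : β → ENNReal) :
    ∑' b, p.bind f b * F b = ∑' a, p a * ∑' b, f a b * F b := by
  simp_rw [PMF.bind_apply, ← ENNReal.tsum_mul_right, ← ENNReal.tsum_mul_left]
  rw [ENNReal.tsum_comm]
  simp_rw [mul_assoc]

theorem PMF.tsum_map_mul {α β : Type*} (p : PMF α) (f : α → β) (F : β → ENNReal) :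
    ∑' b, p.map f b * F b = ∑' a, p a * F (f a) := by
  classical
  rw [← PMF.bind_pure_comp, PMF.tsum_bind_mul]
  refine tsum_congr fun a => ?_
  congr 1
  simp [PMF.pure_apply]

namespace restrictedWreathProduct

variable {H Q : Type*} [Group H] [Group Q]

/-- The lamp configuration of an element. -/
def lamps (g : restrictedWreathProduct H Q) : Q → H := g.1.left

/-- The position of the lamplighter. -/
def site (g : restrictedWreathProduct H Q) : Q := g.1.right

theorem lamps_mul (g g' : restrictedWreathProduct H Q) (x : Q) :
    lamps (g * g') x = lamps g x * lamps g' ((site g)⁻¹ * x) := rfl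

theorem site_mul (g g' : restrictedWreathProduct H Q) : site (g * g') = site g * site g' := rfl

theorem ext_iff' {g g' : restrictedWreathProduct H Q} :
    g = g' ↔ (∀ x, lamps g x = lamps g' x) ∧ site g = site g' := by
  constructor
  · rintro rfl
    exact ⟨fun _ => rfl, rfl⟩
  · rintro ⟨h, h'⟩
    exact Subtype.ext (RegularWreathProduct.ext (funext h) h')

open Classical in
/-- The element that changes only the lamp at the identity. -/
noncomputable def lampAt : H →* restrictedWreathProduct H Q where
  toFun h := ⟨⟨Pi.mulSingle 1 h, 1⟩, (Set.finite_singleton (1 : Q)).subset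
    Pi.mulSupport_mulSingle_subset⟩
  map_one' := ext_iff'.2 ⟨fun x => by simp [lamps], rfl⟩
  map_mul' h h' := ext_iff'.2 ⟨fun x => by simp [lamps, Pi.mulSingle_mul], by simp [site]⟩

/-- The element that moves the lamplighter without touching the lamps. -/
def move : Q →* restrictedWreathProduct H Q where
  toFun y := ⟨⟨1, y⟩, by simp [restrictedWreathProduct]⟩
  map_one' := rfl
  map_mul' _ _ := ext_iff'.2 ⟨fun x => by simp [lamps], rfl⟩

@[simp] theorem lamps_move (y : Q) : lamps (move y : restrictedWreathProduct H Q) = 1 := rfl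

@[simp] theorem site_move (y : Q) : site (move y : restrictedWreathProduct H Q) = y := rfl

open Classical in
@[simp] theorem lamps_lampAt (h : H) :
    lamps (lampAt h : restrictedWreathProduct H Q) = Pi.mulSingle 1 h := rfl

@[simp] theorem site_lampAt (h : H) : site (lampAt h : restrictedWreathProduct H Q) = 1 := rfl

@[simp] theorem lamps_one : lamps (1 : restrictedWreathProduct H Q) = 1 := rfl

@[simp] theorem site_one : site (1 : restrictedWreathProduct H Q) = 1 := rfl

/-- Switch the lamp, walk, and switch the lamp again. -/
noncomputable def swsStep (h : H) (s : Q) (h' : H) : restrictedWreathProduct H Q :=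
  lampAt h * move s * lampAt h'

@[simp] theorem site_swsStep (h : H) (s : Q) (h' : H) : site (swsStep h s h') = s := by
  simp [swsStep, site_mul]

open Classical in
theorem lamps_swsStep (h : H) (s : Q) (h' : H) (x : Q) :
    lamps (swsStep h s h') x =
      (Pi.mulSingle 1 h : Q → H) x * (Pi.mulSingle 1 h' : Q → H) (s⁻¹ * x) := by
  simp [swsStep, lamps_mul, site_mul]

theorem lamps_swsStep_eq_one {h : H} {s : Q} {h' : H} {x : Q} (h1 : x ≠ 1) (hs : x ≠ s) :
    lamps (swsStep h s h') x = 1 := by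
  classical
  have : s⁻¹ * x ≠ 1 := fun h => hs (inv_mul_eq_one.1 h).symm
  rw [lamps_swsStep, Pi.mulSingle_eq_of_ne h1, Pi.mulSingle_eq_of_ne this, one_mul]

theorem swsStep_inv (h : H) (s : Q) (h' : H) : (swsStep h s h')⁻¹ = swsStep h'⁻¹ s⁻¹ h⁻¹ := by
  simp [swsStep, mul_assoc]

end restrictedWreathProduct

/-! ### The switch-walk-switch walk: each record height costs a factor c -/

open restrictedWreathProduct

namespace RandomWalk

variable {H Q : Type*} [Group H] [Group Q]

/-- The switch-walk-switch law: the lamp is switched by `η` before and after a step of law `ρ`. -/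
noncomputable def switchWalkSwitch (η : PMF H) (ρ : PMF Q) : PMF (restrictedWreathProduct H Q) :=
  η.bind fun h => ρ.bind fun s => η.map fun h' => swsStep h s h'

theorem tsum_switchWalkSwitch_mul (η : PMF H) (ρ : PMF Q)
    (F : restrictedWreathProduct H Q → ENNReal) :
    ∑' g, switchWalkSwitch η ρ g * F g =
      ∑' h, η h * ∑' s, ρ s * ∑' h', η h' * F (swsStep h s h') := by
  simp_rw [switchWalkSwitch, PMF.tsum_bind_mul, PMF.tsum_map_mul]

theorem mem_support_switchWalkSwitch {η : PMF H} {ρ : PMF Q} {g : restrictedWreathProduct H Q} :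
    g ∈ (switchWalkSwitch η ρ).support ↔
      ∃ h ∈ η.support, ∃ s ∈ ρ.support, ∃ h' ∈ η.support, swsStep h s h' = g := by
  simp [switchWalkSwitch]

/-- The running maximum of the level along a word. -/
def maxLevel (lev : Q → ℤ) : List (restrictedWreathProduct H Q) → ℕ
  | [] => 0
  | g :: l => max (maxLevel lev l) (lev (site (wordProd (g :: l)))).toNat

/-- The lamplighter is at level at most `m`, and so are all lamps that are on. -/
def IsBelow (lev : Q → ℤ) (m : ℤ) (g : restrictedWreathProduct H Q) : Prop :=
  lev (site g) ≤ m ∧ ∀ x, m < lev x → lamps g x = 1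

/-- A step touches only the lamps at its two endpoints. -/
theorem IsBelow.mul_swsStep {lev : Q → ℤ} {m m' : ℤ} {g : restrictedWreathProduct H Q}
    (hg : IsBelow lev m g) (hm : m ≤ m') {s : Q} (hs : lev (site g * s) ≤ m') (h h' : H) :
    IsBelow lev m' (g * swsStep h s h') := by
  refine ⟨by simpa [site_mul] using hs, fun x hx => ?_⟩
  rw [lamps_mul, hg.2 x (hm.trans_lt hx), one_mul]
  refine lamps_swsStep_eq_one (fun h1 => ?_) fun h1 => ?_
  · have := hg.1
    rw [inv_mul_eq_one.1 h1] at this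
    omega
  · rw [inv_mul_eq_iff_eq_mul] at h1
    rw [h1] at hx
    omega

variable {lev : Q → ℤ} {η : PMF H} {ρ : PMF Q}

theorem isBelow_maxLevel_cons {l : List (restrictedWreathProduct H Q)}
    {g : restrictedWreathProduct H Q}
    (hl : IsBelow lev (maxLevel lev l) (wordProd l)) (hg : g ∈ (switchWalkSwitch η ρ).support) :
    IsBelow lev (maxLevel lev (g :: l)) (wordProd (g :: l)) := by
  obtain ⟨h, -, s, -, h', -, rfl⟩ := mem_support_switchWalkSwitch.1 hg
  refine hl.mul_swsStep (by simp [maxLevel]) ?_ h h'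
  simp [maxLevel, wordProd, site_mul]

-- Induction on time, peeling off the latest step. A record step above `a` ends at an untouched
-- lamp, so a single value of the closing switch meets the target there, at cost `c`; any other step
-- merely pulls the target back. Target and weight are arbitrary functions of site and maximum
-- because peeling changes both.
open Classical in
theorem wordExp_lamps_le (hlev : ∀ x y, lev (x * y) = lev x + lev y)
    {c : ENNReal} (hη : ∀ h, η h ≤ c) (hρ : ∀ s ∈ ρ.support, lev s ≤ 1) (a n : ℕ)
    (ψ : Q → ℕ → ENNReal) (T : Q → ℕ → Q → H) :
    wordExp (switchWalkSwitch η ρ) n (fun l =>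
        if ∀ x, (a : ℤ) < lev x → lamps (wordProd l) x = T (site (wordProd l)) (maxLevel lev l) x
        then ψ (site (wordProd l)) (maxLevel lev l) else 0) ≤
      wordExp (switchWalkSwitch η ρ) n fun l =>
        ψ (site (wordProd l)) (maxLevel lev l) * c ^ (maxLevel lev l - a) := by
  have lev_one : lev 1 = 0 := by simpa using hlev 1 1
  have hp0 : IsBelow lev (maxLevel lev ([] : List (restrictedWreathProduct H Q)))
      (wordProd [] : restrictedWreathProduct H Q) :=
    ⟨by simp [maxLevel, wordProd, lev_one], fun x _ => by simp [wordProd]⟩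
  induction n generalizing ψ T with
  | zero =>
    simp only [wordExp, maxLevel, Nat.zero_sub, pow_zero, mul_one]
    exact (ite_le_sup _ _ _).trans (by simp)
  | succ n ih =>
    simp only [wordExp, tsum_switchWalkSwitch_mul]
    let M' : Q → ℕ → Q → ℕ := fun y M s => max M (lev (y * s)).toNat
    -- Records made while the maximum is below `a` do not count: the truncated exponent `maxLevel -
    -- a` stays zero.
    let new : Q → ℕ → Q → Prop := fun y M s => M < (lev (y * s)).toNat ∧ a ≤ M
    let κ : Q → ℕ → Q → ENNReal := fun y M s => if new y M s then c else 1
    -- The target for the lamps before the step. On a counted record it requires the arrival lamp to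
    -- be off and does not involve `h'`, so the sum over `h'` factors out.
    let T' : H → Q → H → Q → ℕ → Q → H := fun h s h' y M x =>
      if new y M s then
        if x = y * s then 1
        else T (y * s) (M' y M s) x * ((Pi.mulSingle 1 h : Q → H) (y⁻¹ * x))⁻¹
      else T (y * s) (M' y M s) x * (lamps (swsStep h s h') (y⁻¹ * x))⁻¹
    have h1 : ∀ l : List (restrictedWreathProduct H Q),
        IsBelow lev (maxLevel lev l) (wordProd l) → ∀ h s,
        (∑' h', η h' * if ∀ x, (a : ℤ) < lev x →
            (lamps (wordProd (swsStep h s h' :: l))) x = T (site (wordProd (swsStep h s h' :: l)))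
              (maxLevel lev (swsStep h s h' :: l)) x
          then ψ (site (wordProd (swsStep h s h' :: l))) (maxLevel lev (swsStep h s h' :: l))
          else 0) ≤
        ∑' h', η h' * if ∀ x, (a : ℤ) < lev x →
            lamps (wordProd l) x = T' h s h' (site (wordProd l)) (maxLevel lev l) x
          then κ (site (wordProd l)) (maxLevel lev l) s *
            ψ (site (wordProd l) * s) (M' (site (wordProd l)) (maxLevel lev l) s) else 0 := by
      intro l hl h s
      simp only [wordProd, maxLevel, site_mul, site_swsStep, lamps_mul]
      by_cases hnew : new (site (wordProd l)) (maxLevel lev l) s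
      · simp only [T', κ, if_pos hnew]
        obtain ⟨hn1, hn2⟩ := hnew
        set y := site (wordProd l)
        set M := maxLevel lev l
        have hys : (M : ℤ) < lev (y * s) := by omega
        have hs1 : s ≠ 1 := by
          rintro rfl
          have := hl.1
          rw [mul_one] at hys
          exact absurd (hys.trans_le this) (lt_irrefl _)
        set Z : ENNReal := if ∀ x, (a : ℤ) < lev x → lamps (wordProd l) x =
            if x = y * s then 1
            else T (y * s) (M' y M s) x * ((Pi.mulSingle 1 h : Q → H) (y⁻¹ * x))⁻¹
          then ψ (y * s) (M' y M s) else 0 with hZ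
        have hR : ∀ p : Prop, [Decidable p] → (if p then c * ψ (y * s) (M' y M s) else 0) =
            c * if p then ψ (y * s) (M' y M s) else 0 := fun p _ => by split_ifs <;> simp
        simp only [hR, ← hZ]
        rw [ENNReal.tsum_mul_right, PMF.tsum_coe, one_mul]
        -- The only closing switch compatible with the target at the arrival site.
        set h₀ := T (y * s) (M' y M s) (y * s)
        calc _ ≤ ∑' h', η h' * if h' = h₀ then Z else 0 := by
              refine ENNReal.tsum_le_tsum fun h' => mul_le_mul_right ?_ _
              split_ifs with hA hB hB
              · rw [hZ, if_pos]
                intro x hx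
                have hAx := hA x hx
                by_cases hxy : x = y * s
                · rw [if_pos hxy, hxy]
                  exact hl.2 _ hys
                · have hne : s⁻¹ * (y⁻¹ * x) ≠ 1 := by
                    rw [Ne, inv_mul_eq_one, eq_inv_mul_iff_mul_eq]
                    exact fun h => hxy h.symm
                  rw [if_neg hxy, eq_mul_inv_iff_mul_eq, ← hAx, lamps_swsStep,
                    Pi.mulSingle_eq_of_ne hne, mul_one]
              · refine absurd ?_ hB
                have hAx := hA (y * s) (by omega)
                rw [hl.2 _ hys, one_mul, inv_mul_cancel_left, lamps_swsStep,
                  Pi.mulSingle_eq_of_ne hs1, one_mul, inv_mul_cancel, Pi.mulSingle_eq_same] at hAx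
                exact hAx
              · exact bot_le
              · exact bot_le
          _ = η h₀ * Z := by
              rw [tsum_eq_single h₀]
              · simp
              · intro b hb
                simp [hb]
          _ ≤ c * Z := mul_le_mul_left (hη _) _
      · simp only [T', κ, if_neg hnew, one_mul, M', eq_mul_inv_iff_mul_eq]
        exact le_rfl
    have h2 : ∀ l : List (restrictedWreathProduct H Q),
        IsBelow lev (maxLevel lev l) (wordProd l) → ∀ s ∈ ρ.support, ∀ h h',
        κ (site (wordProd l)) (maxLevel lev l) s *
            ψ (site (wordProd l) * s) (M' (site (wordProd l)) (maxLevel lev l) s) *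
              c ^ (maxLevel lev l - a) ≤
          ψ (site (wordProd (swsStep h s h' :: l))) (maxLevel lev (swsStep h s h' :: l)) *
            c ^ (maxLevel lev (swsStep h s h' :: l) - a) := by
      intro l hl s hs h h'
      simp only [wordProd, maxLevel, site_mul, site_swsStep]
      have hb := hl.1
      set y := site (wordProd l)
      set M := maxLevel lev l
      have hls := hlev y s
      have hs1 := hρ s hs
      rw [mul_comm (κ y M s), mul_assoc]
      refine mul_le_mul_right ?_ _
      by_cases hnew : new y M s
      · simp only [κ, if_pos hnew]
        obtain ⟨hn1, hn2⟩ := hnew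
        -- Height steps are at most 1, so a record raises the maximum by exactly one.
        rw [← pow_succ', show max M (lev (y * s)).toNat - a = M - a + 1 by omega]
      · simp only [κ, if_neg hnew, one_mul]
        simp only [new, not_and_or] at hnew
        rw [show max M (lev (y * s)).toNat - a = M - a by omega]
    refine (wordExp_mono_of_support _ (p := fun l => IsBelow lev (maxLevel lev l) (wordProd l)) hp0
      (fun g l hl hg => isBelow_maxLevel_cons hl hg) fun l hl => ENNReal.tsum_le_tsum fun h =>
        mul_le_mul_right (ENNReal.tsum_le_tsum fun s =>
          mul_le_mul_right (h1 l hl h s) _) _).trans ?_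
    simp_rw [wordExp_tsum, wordExp_const_mul, wordExp_tsum, wordExp_const_mul, wordExp_tsum,
      wordExp_const_mul]
    refine ENNReal.tsum_le_tsum fun h => mul_le_mul_right (ENNReal.tsum_le_tsum fun s => ?_) _
    by_cases hs : ρ s = 0
    · simp [hs]
    refine mul_le_mul_right (ENNReal.tsum_le_tsum fun h' => mul_le_mul_right ?_ _) _
    refine (ih (fun y M => κ y M s * ψ (y * s) (M' y M s)) (T' h s h')).trans ?_
    exact wordExp_mono_of_support _ (p := fun l => IsBelow lev (maxLevel lev l) (wordProd l)) hp0
      (fun g l hl hg => isBelow_maxLevel_cons hl hg) fun l hl => h2 l hl s hs h h'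

end RandomWalk

/-! ### Counting visits to cleared sets -/

namespace RandomWalk

variable {H Q : Type*} [Group H] [Group Q]

theorem IsSymmetric.tsum_inv {G : Type*} [Group G] {μ : PMF G} (hμ : IsSymmetric μ)
    (F : G → ENNReal) : ∑' g, μ g * F g⁻¹ = ∑' g, μ g * F g := by
  rw [← (Equiv.inv G).tsum_eq]
  simp [hμ _]

theorem lev_site_le_maxLevel {lev : Q → ℤ} (h1 : lev 1 = 0)
    (l : List (restrictedWreathProduct H Q)) : lev (site (wordProd l)) ≤ maxLevel lev l := by
  cases l with
  | nil => simp [wordProd, maxLevel, h1]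
  | cons g l => simp [maxLevel]

variable {lev : Q → ℤ} {μ : PMF (restrictedWreathProduct H Q)}

open Classical in
/-- The probability that a step changes the level. -/
noncomputable def levelChangeProb (lev : Q → ℤ) (μ : PMF (restrictedWreathProduct H Q)) :
    ENNReal :=
  ∑' g, μ g * if lev (site g) ≠ 0 then 1 else 0

/-- The distance to `N + 1`, capped at its value at `m`; it is superharmonic for the level. -/
def levelBarrier (N m k : ℤ) : ℕ := (N + 1 - max k m).toNat

-- Symmetry pairs each step with its inverse, which reduces the claim to concavity of the barrier in
-- the height; its kink at `m` yields the extra term. Since `k ≤ N`, one step never passes the zero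
-- at `N + 1`.
open Classical in
theorem tsum_levelBarrier_le (hlev : ∀ x y, lev (x * y) = lev x + lev y) (hμ : IsSymmetric μ)
    (hstep : ∀ g ∈ μ.support, |lev (site g)| ≤ 1) {N m k : ℤ} (hk : k ≤ N) :
    2 * (∑' g, μ g * (levelBarrier N m (k + lev (site g)) : ENNReal)) +
        levelChangeProb lev μ * (if k = m then 1 else 0) ≤
      2 * (levelBarrier N m k : ENNReal) := by
  have lev_one : lev 1 = 0 := by simpa using hlev 1 1
  have lev_inv : ∀ x, lev x⁻¹ = - lev x := fun x => by
    have := hlev x x⁻¹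
    rw [mul_inv_cancel, lev_one] at this
    omega
  have h1 : ∑' g, μ g * (levelBarrier N m (k + lev (site g)) : ENNReal) =
      ∑' g, μ g * (levelBarrier N m (k - lev (site g)) : ENNReal) := by
    rw [← hμ.tsum_inv]
    refine tsum_congr fun g => ?_
    rw [show site g⁻¹ = (site g)⁻¹ from rfl, lev_inv, sub_eq_add_neg]
  rw [two_mul]
  nth_rewrite 2 [h1]
  rw [← ENNReal.tsum_add, levelChangeProb, ← ENNReal.tsum_mul_right, ← ENNReal.tsum_add]
  calc _ ≤ ∑' g, μ g * (2 * (levelBarrier N m k : ENNReal)) := by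
        refine ENNReal.tsum_le_tsum fun g => ?_
        by_cases hg : μ g = 0
        · simp [hg]
        rw [mul_assoc, ← mul_add, ← mul_add]
        refine mul_le_mul_right ?_ _
        have h2 := abs_le.1 (hstep g hg)
        have h3 : levelBarrier N m (k + lev (site g)) + levelBarrier N m (k - lev (site g)) +
            (if lev (site g) ≠ 0 then 1 else 0) * (if k = m then 1 else 0) ≤
            2 * levelBarrier N m k := by
          simp only [levelBarrier]
          obtain h | h | h : lev (site g) = 1 ∨ lev (site g) = 0 ∨ lev (site g) = -1 := by omega
          all_goals rw [h]; split_ifs <;> omega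
        exact_mod_cast h3
    _ = _ := by rw [ENNReal.tsum_mul_right, PMF.tsum_coe, one_mul]

-- The barrier, set to zero once the maximum exceeds `m + i`, is a supermartingale losing at least
-- half of `levelChangeProb` on average at each visit counted. Telescoping bounds the total loss by
-- its initial value, at most `i + 1`.
open Classical in
theorem levelChangeProb_mul_tsum_visits_le (hlev : ∀ x y, lev (x * y) = lev x + lev y)
    (hμ : IsSymmetric μ) (hstep : ∀ g ∈ μ.support, |lev (site g)| ≤ 1) (m i : ℕ) :
    levelChangeProb lev μ * ∑' n, wordExp μ n (fun l =>
      if maxLevel lev l ≤ m + i ∧ lev (site (wordProd l)) = m then 1 else 0) ≤ 2 * (i + 1) := by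
  have lev_one : lev 1 = 0 := by simpa using hlev 1 1
  set V : List (restrictedWreathProduct H Q) → ENNReal := fun l =>
    if maxLevel lev l ≤ m + i then
      (levelBarrier (m + i : ℕ) m (lev (site (wordProd l))) : ENNReal) else 0
  set U : List (restrictedWreathProduct H Q) → ENNReal := fun l =>
    if maxLevel lev l ≤ m + i ∧ lev (site (wordProd l)) = m then 1 else 0
  have hstep' : ∀ n, 2 * wordExp μ (n + 1) V + levelChangeProb lev μ * wordExp μ n U ≤
      2 * wordExp μ n V := by
    intro n
    simp only [wordExp, ← wordExp_const_mul, ← wordExp_add]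
    refine wordExp_mono μ fun l => ?_
    by_cases hl : maxLevel lev l ≤ m + i
    · have hk := lev_site_le_maxLevel lev_one l
      refine le_trans ?_ ((tsum_levelBarrier_le (N := (m + i : ℕ)) (m := m) hlev hμ hstep
        (hk.trans (by exact_mod_cast hl))).trans (by simp only [V, if_pos hl, le_refl]))
      refine add_le_add (mul_le_mul_right (ENNReal.tsum_le_tsum fun g =>
        mul_le_mul_right ?_ _) _) ?_
      · refine (ite_le_sup _ _ _).trans ?_
        simp [wordProd, site_mul, hlev]
      · simp [U, hl]
    · have : ∀ g, ¬ maxLevel lev (g :: l) ≤ m + i := fun g h =>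
        hl (le_trans (by simp [maxLevel]) h)
      simp [V, U, hl, this]
  have hsum : ∀ L, levelChangeProb lev μ * ∑ n ∈ Finset.range L, wordExp μ n U +
      2 * wordExp μ L V ≤ 2 * wordExp μ 0 V := by
    intro L
    induction L with
    | zero => simp
    | succ L ih =>
      rw [Finset.sum_range_succ, mul_add, add_assoc, add_comm (_ * wordExp μ L U)]
      exact (add_le_add_right (hstep' L) _).trans ih
  have hV : wordExp μ 0 V ≤ (i : ENNReal) + 1 := by
    simp only [wordExp, V, maxLevel, wordProd, site_one, lev_one, levelBarrier]
    rw [if_pos (Nat.zero_le _)]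
    have : ((m + i : ℕ) + 1 - max 0 (m : ℤ)).toNat ≤ i + 1 := by omega
    exact_mod_cast this
  rw [ENNReal.tsum_eq_iSup_nat, ENNReal.mul_iSup]
  refine iSup_le fun L => (le_self_add.trans (hsum L)).trans (mul_le_mul_right hV _)

/-- The lamplighter is at level `m` and all lamps above level `a` are off. -/
def clearedSet (H : Type*) [Group H] (lev : Q → ℤ) (a m : ℕ) : Set (restrictedWreathProduct H Q) :=
  {g | lev (site g) = m ∧ ∀ x, (a : ℤ) < lev x → lamps g x = 1}

-- At height `m` the maximum is `m + i` for some `i ≥ 0`; the records then cost `c ^ (m - a + i)`,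
-- and the number of such visits is linear in `i` on average.
open Classical in
theorem levelChangeProb_mul_tsum_clearedSet_le (hlev : ∀ x y, lev (x * y) = lev x + lev y)
    {η : PMF H} {ρ : PMF Q} {c : ENNReal} (hη : ∀ h, η h ≤ c)
    (hρ : ∀ s ∈ ρ.support, |lev s| ≤ 1) (hμ : IsSymmetric (switchWalkSwitch η ρ)) {a m : ℕ}
    (ham : a ≤ m) :
    levelChangeProb lev (switchWalkSwitch η ρ) * ∑' n, wordExp (switchWalkSwitch η ρ) n (fun l =>
      if wordProd l ∈ clearedSet H lev a m then 1 else 0) ≤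
      c ^ (m - a) * ∑' i : ℕ, c ^ i * (2 * (i + 1)) := by
  have lev_one : lev 1 = 0 := by simpa using hlev 1 1
  set μ := switchWalkSwitch η ρ
  have hstep : ∀ g ∈ μ.support, |lev (site g)| ≤ 1 := by
    intro g hg
    obtain ⟨h, -, s, hs, h', -, rfl⟩ := mem_support_switchWalkSwitch.1 hg
    simpa using hρ s hs
  have h1 : ∀ n, wordExp μ n (fun l => if wordProd l ∈ clearedSet H lev a m then 1 else 0) ≤
      ∑' i : ℕ, c ^ (m - a) * (c ^ i * wordExp μ n fun l =>
        if maxLevel lev l ≤ m + i ∧ lev (site (wordProd l)) = m then 1 else 0) := by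
    intro n
    have h2 := wordExp_lamps_le hlev hη (fun s hs => (abs_le.1 (hρ s hs)).2) a n
      (fun y _ => if lev y = m then 1 else 0) fun _ _ _ => 1
    refine le_trans (wordExp_mono _ fun l => ?_) (h2.trans ?_)
    · by_cases h : wordProd l ∈ clearedSet H lev a m
      · rw [if_pos h, if_pos h.2, if_pos h.1]
      · simp [h]
    · simp_rw [← wordExp_const_mul, ← wordExp_tsum]
      refine wordExp_mono _ fun l => ?_
      by_cases h : lev (site (wordProd l)) = m
      · have hM : m ≤ maxLevel lev l := by
          have := lev_site_le_maxLevel lev_one l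
          omega
        -- Only the term `i = maxLevel - m` of the series is needed.
        refine le_trans ?_ (ENNReal.le_tsum (maxLevel lev l - m))
        rw [if_pos h, if_pos ⟨by omega, h⟩, one_mul, mul_one, ← pow_add,
          show m - a + (maxLevel lev l - m) = maxLevel lev l - a by omega]
      · simp [h]
  calc _ ≤ levelChangeProb lev μ * ∑' n, ∑' i : ℕ, c ^ (m - a) * (c ^ i * wordExp μ n fun l =>
        if maxLevel lev l ≤ m + i ∧ lev (site (wordProd l)) = m then 1 else 0) :=
        mul_le_mul_right (ENNReal.tsum_le_tsum h1) _
    _ = c ^ (m - a) * ∑' i : ℕ, c ^ i * (levelChangeProb lev μ * ∑' n, wordExp μ n fun l =>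
        if maxLevel lev l ≤ m + i ∧ lev (site (wordProd l)) = m then 1 else 0) := by
        rw [ENNReal.tsum_comm]
        simp_rw [← ENNReal.tsum_mul_left]
        refine tsum_congr fun i => tsum_congr fun n => ?_
        ring
    _ ≤ _ := mul_le_mul_right (ENNReal.tsum_le_tsum fun i => mul_le_mul_right
        (levelChangeProb_mul_tsum_visits_le hlev hμ hstep m i) _) _

theorem tsum_pow_mul_ne_top {c : ENNReal} (hc : c < 1) :
    ∑' i : ℕ, c ^ i * (2 * ((i : ENNReal) + 1)) ≠ ⊤ := by
  lift c to NNReal using hc.ne_top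
  have hc' : ‖(c : ℝ)‖ < 1 := by simpa using hc
  have h1 : Summable fun i : ℕ => (c : ℝ) ^ i * (2 * ((i : ℝ) + 1)) := by
    have h2 := (summable_pow_mul_geometric_of_norm_lt_one 1 hc').add
      (summable_geometric_of_norm_lt_one hc')
    refine (h2.mul_left 2).congr fun i => ?_
    ring
  have h3 : Summable fun i : ℕ => c ^ i * (2 * ((i : NNReal) + 1)) := by
    rw [← NNReal.summable_coe]
    exact_mod_cast h1
  have h4 := ENNReal.tsum_coe_ne_top_iff_summable.2 h3
  push_cast at h4
  exact h4

/-- The number of visits to `clearedSet` has expectation at most a constant times `c ^ (m - a)`. -/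
theorem exists_tsum_clearedSet_le (hlev : ∀ x y, lev (x * y) = lev x + lev y)
    {η : PMF H} {ρ : PMF Q} {c : ENNReal} (hc : c < 1) (hη : ∀ h, η h ≤ c)
    (hρ : ∀ s ∈ ρ.support, |lev s| ≤ 1) (hμ : IsSymmetric (switchWalkSwitch η ρ))
    {t : restrictedWreathProduct H Q} (ht : t ∈ (switchWalkSwitch η ρ).support)
    (ht1 : lev (site t) = 1) : by
    classical exact
    ∃ C : ENNReal, C ≠ ⊤ ∧ ∀ a m : ℕ, a ≤ m →
      ∑' n, wordExp (switchWalkSwitch η ρ) n (fun l =>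
        if wordProd l ∈ clearedSet H lev a m then 1 else 0) ≤ C * c ^ (m - a) := by
  classical
  set p := levelChangeProb lev (switchWalkSwitch η ρ)
  have hp0 : p ≠ 0 := by
    intro h
    have := ENNReal.tsum_eq_zero.1 h t
    simp only [ht1] at this
    exact ht (by simpa using this)
  have hp1 : p ≠ ⊤ := by
    refine ne_top_of_le_ne_top (PMF.tsum_coe_ne_top (switchWalkSwitch η ρ))
      (ENNReal.tsum_le_tsum fun g => ?_)
    split_ifs <;> simp
  refine ⟨p⁻¹ * ∑' i : ℕ, c ^ i * (2 * (i + 1)),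
    ENNReal.mul_ne_top (ENNReal.inv_ne_top.2 hp0) (tsum_pow_mul_ne_top hc), fun a m ham => ?_⟩
  have h := levelChangeProb_mul_tsum_clearedSet_le hlev hη hρ hμ ham
  rw [mul_comm, ← ENNReal.le_div_iff_mul_le (Or.inl hp0) (Or.inl hp1), ENNReal.div_eq_inv_mul] at h
  refine h.trans (le_of_eq ?_)
  ring

end RandomWalk

/-! ### Lower bound for Green's function; transience of the union of cleared sets -/

namespace RandomWalk

section green

variable {G : Type*} [Group G] (μ : PMF G)

open Classical in
theorem green_one_le_of_mem {S : Set G} {x : G} (hx : x ∈ S) :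
    green μ 1 x ≤ ∑' n, wordExp μ n fun l => if wordProd l ∈ S then 1 else 0 := by
  refine ENNReal.tsum_le_tsum fun n => ?_
  rw [inv_one, one_mul, convPow_apply_eq_wordExp]
  refine wordExp_mono μ fun l => ?_
  by_cases h : wordProd l = x
  · simp [h, hx]
  · simp [h]

theorem le_map_mul_left (y s : G) : μ s ≤ (μ.map fun h => y * h) (y * s) := by
  classical
  rw [PMF.map_apply]
  exact le_trans (by simp) (ENNReal.le_tsum s)

/-- Retain only the last steps `t` and `t⁻¹`; `t * t ≠ 1` makes the two predecessors distinct, so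
their contributions add. -/
theorem convPow_succ_ge {t : G} (ht : t * t ≠ 1) {b : ENNReal} (hb : b ≤ μ t) (hb' : b ≤ μ t⁻¹)
    (n : ℕ) (x : G) :
    b * (convPow μ n (x * t⁻¹) + convPow μ n (x * t)) ≤ convPow μ (n + 1) x := by
  classical
  have hne : x * t⁻¹ ≠ x * t := fun h => ht (by
    rw [mul_left_cancel_iff, inv_eq_iff_mul_eq_one] at h
    exact h)
  simp only [convPow, PMF.bind_apply]
  refine le_trans ?_ (ENNReal.sum_le_tsum {x * t⁻¹, x * t})
  rw [Finset.sum_pair hne, mul_add, mul_comm b, mul_comm b]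
  refine add_le_add (mul_le_mul_right (hb.trans ?_) _) (mul_le_mul_right (hb'.trans ?_) _)
  · simpa using le_map_mul_left μ (x * t⁻¹) t
  · simpa using le_map_mul_left μ (x * t) t⁻¹

theorem green_one_ge {t : G} (ht : t * t ≠ 1) {b : ENNReal} (hb : b ≤ μ t) (hb' : b ≤ μ t⁻¹)
    (x : G) [Decidable (x = 1)] :
    (if x = 1 then 1 else 0) + b * (green μ 1 (x * t⁻¹) + green μ 1 (x * t)) ≤ green μ 1 x := by
  simp only [green, inv_one, one_mul]
  rw [tsum_eq_zero_add' (f := fun n => convPow μ n x) ENNReal.summable, ← ENNReal.tsum_add,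
    ← ENNReal.tsum_mul_left]
  refine add_le_add (le_of_eq ?_) (ENNReal.tsum_le_tsum fun n => convPow_succ_ge μ ht hb hb' n x)
  simp [convPow, PMF.pure_apply]

/-- Green's function decays at most exponentially along a cyclic subgroup. -/
theorem pow_le_green {t : G} (ht : ∀ z : ℤ, t ^ z = 1 → z = 0) {b θ : ENNReal} (hb : b ≤ μ t)
    (hb' : b ≤ μ t⁻¹) (hb1 : 2 * b < 1) (hθ : θ ≤ 1) (hθb : θ ≤ b * (1 + θ ^ 2)) (n : ℕ) :
    θ ^ n ≤ green μ 1 (t ^ n) := by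
  classical
  have ht2 : t * t ≠ 1 := fun h => absurd (ht 2 (by rw [zpow_two, h])) (by norm_num)
  -- `θ ^ |z|` is a subsolution of the inequality that Green's function satisfies as a
  -- supersolution; at `z = 0` the source term alone suffices.
  have hd : ∀ z : ℤ, θ ^ z.natAbs ≤ (if z = 0 then 1 else 0) +
      b * (θ ^ (z - 1).natAbs + θ ^ (z + 1).natAbs) := by
    intro z
    by_cases hz : z = 0
    · simp [hz]
    · rw [if_neg hz, zero_add]
      obtain ⟨k, hk⟩ : ∃ k, z.natAbs = k + 1 := ⟨z.natAbs - 1, by omega⟩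
      have h1 : θ ^ (z - 1).natAbs + θ ^ (z + 1).natAbs = θ ^ k * (1 + θ ^ 2) := by
        obtain ⟨h1, h2⟩ | ⟨h1, h2⟩ : ((z - 1).natAbs = k ∧ (z + 1).natAbs = k + 2) ∨
            ((z - 1).natAbs = k + 2 ∧ (z + 1).natAbs = k) := by omega
        all_goals rw [h1, h2]; ring
      rw [h1, hk, pow_succ, mul_left_comm]
      exact mul_le_mul_right hθb _
  -- Comparison by iteration: the initial error is at most 1, and each round multiplies it by `2 * b
  -- < 1`.
  have key : ∀ (N : ℕ) (z : ℤ), θ ^ z.natAbs ≤ green μ 1 (t ^ z) + (2 * b) ^ N := by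
    intro N
    induction N with
    | zero => exact fun z => (pow_le_one₀ bot_le hθ).trans (by simp)
    | succ N ih =>
      intro z
      calc θ ^ z.natAbs ≤ (if z = 0 then 1 else 0) +
            b * (θ ^ (z - 1).natAbs + θ ^ (z + 1).natAbs) := hd z
        _ ≤ (if z = 0 then 1 else 0) + b * ((green μ 1 (t ^ (z - 1)) + (2 * b) ^ N) +
            (green μ 1 (t ^ (z + 1)) + (2 * b) ^ N)) := by
            gcongr
            exacts [ih _, ih _]
        _ = ((if t ^ z = 1 then 1 else 0) + b * (green μ 1 (t ^ z * t⁻¹) +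
            green μ 1 (t ^ z * t))) + (2 * b) ^ (N + 1) := by
            rw [zpow_sub_one, zpow_add_one]
            have : z = 0 ↔ t ^ z = 1 := ⟨fun h => by rw [h, zpow_zero], ht z⟩
            simp only [this]
            ring
        _ ≤ _ := by gcongr; exact green_one_ge μ ht2 hb hb' _
  have hlim : Tendsto (fun N => green μ 1 (t ^ n) + (2 * b) ^ N) atTop
      (𝓝 (green μ 1 (t ^ n) + 0)) :=
    tendsto_const_nhds.add (ENNReal.tendsto_pow_atTop_nhds_zero_of_lt_one hb1)
  rw [add_zero] at hlim
  exact ge_of_tendsto' hlim fun N => by simpa using key N n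

end green

variable {H Q : Type*} [Group H] [Group Q] {lev : Q → ℤ}

theorem isTransientSet_iUnion_clearedSet (hlev : ∀ x y, lev (x * y) = lev x + lev y)
    {η : PMF H} {ρ : PMF Q} {c : ENNReal} (hc : c < 1) (hη : ∀ h, η h ≤ c)
    (hρ : ∀ s ∈ ρ.support, |lev s| ≤ 1) (hμ : IsSymmetric (switchWalkSwitch η ρ))
    (hfin : (switchWalkSwitch η ρ).support.Finite)
    {t : restrictedWreathProduct H Q} (ht : t ∈ (switchWalkSwitch η ρ).support)
    (ht1 : lev (site t) = 1) {A : ℕ → ℕ} (hA : Monotone A)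
    (hsum : ∑' j, c ^ (A (j + 1) - A j) ≠ ⊤) :
    IsTransientSet (switchWalkSwitch η ρ) (⋃ j, clearedSet H lev (A j) (A (j + 1))) := by
  classical
  obtain ⟨C, hC, h⟩ := exists_tsum_clearedSet_le hlev hc hη hρ hμ ht ht1
  refine isTransientSet_of_tsum_ne_top _ hfin _ ?_
  refine ne_top_of_le_ne_top (ENNReal.mul_ne_top hC hsum) ?_
  calc _ ≤ ∑' n, ∑' j, wordExp (switchWalkSwitch η ρ) n (fun l =>
        if wordProd l ∈ clearedSet H lev (A j) (A (j + 1)) then 1 else 0) := by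
        refine ENNReal.tsum_le_tsum fun n => ?_
        rw [← wordExp_tsum]
        refine wordExp_mono _ fun l => ?_
        split_ifs with hl
        · obtain ⟨j, hj⟩ := Set.mem_iUnion.1 hl
          exact le_trans (by rw [if_pos hj]) (ENNReal.le_tsum j)
        · exact bot_le
    _ = ∑' j, ∑' n, wordExp (switchWalkSwitch η ρ) n (fun l =>
        if wordProd l ∈ clearedSet H lev (A j) (A (j + 1)) then 1 else 0) := ENNReal.tsum_comm
    _ ≤ ∑' j, C * c ^ (A (j + 1) - A j) :=
        ENNReal.tsum_le_tsum fun j => h _ _ (hA j.le_succ)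
    _ = _ := ENNReal.tsum_mul_left

end RandomWalk

/-! ### Avoidance probabilities and the maximum principle on half-spaces -/

namespace RandomWalk

section stepMean

variable {G : Type*} [Group G] {μ : PMF G} (hfin : μ.support.Finite)

/-- The one-step operator of the walk on real functions. -/
noncomputable def stepMean (u : G → ℝ) (g : G) : ℝ :=
  ∑ s ∈ hfin.toFinset, (μ s).toReal * u (g * s)

theorem sum_toReal_eq_one : ∑ s ∈ hfin.toFinset, (μ s).toReal = 1 := by
  rw [← ENNReal.toReal_sum fun s _ => μ.apply_ne_top s]
  have : ∑ s ∈ hfin.toFinset, μ s = ∑' s, μ s :=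
    (tsum_eq_sum fun s hs => by simpa using hs).symm
  rw [this, PMF.tsum_coe, ENNReal.toReal_one]

theorem stepMean_le_of_le {u : G → ℝ} {g : G} {M : ℝ} (h : ∀ s ∈ μ.support, u (g * s) ≤ M) :
    stepMean hfin u g ≤ M := by
  rw [← one_mul M, ← sum_toReal_eq_one hfin, Finset.sum_mul]
  exact Finset.sum_le_sum fun s hs =>
    mul_le_mul_of_nonneg_left (h s (by simpa using hs)) ENNReal.toReal_nonneg

theorem stepMean_sub (u v : G → ℝ) (g : G) :
    stepMean hfin (fun g => u g - v g) g = stepMean hfin u g - stepMean hfin v g := by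
  simp [stepMean, mul_sub, Finset.sum_sub_distrib]

theorem stepMean_const_mul (c : ℝ) (u : G → ℝ) (g : G) :
    stepMean hfin (fun g => c * u g) g = c * stepMean hfin u g := by
  simp [stepMean, Finset.mul_sum, mul_left_comm]

theorem stepMean_const (c : ℝ) (g : G) : stepMean hfin (fun _ => c) g = c := by
  rw [stepMean, ← Finset.sum_mul, sum_toReal_eq_one, one_mul]

theorem killedStep_apply (S : Set G) [DecidablePred (· ∈ S)] (φ : G → ENNReal) (g : G) :
    killedStep μ S φ g = if g ∈ S then 0 else ∑' s, μ s * φ (g * s) := by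
  rw [killedStep]
  congr

theorem killedStep_eq_sum (S : Set G) [DecidablePred (· ∈ S)] (φ : G → ENNReal) (g : G) :
    killedStep μ S φ g = if g ∈ S then 0 else ∑ s ∈ hfin.toFinset, μ s * φ (g * s) := by
  rw [killedStep_apply]
  have : ∑' s, μ s * φ (g * s) = ∑ s ∈ hfin.toFinset, μ s * φ (g * s) :=
    tsum_eq_sum fun s hs => by
      have : μ s = 0 := by simpa using hs
      simp [this]
  rw [this]

theorem killedStep_mono (S : Set G) : Monotone (killedStep μ S) := by
  classical
  intro φ φ' h g
  rw [killedStep_apply, killedStep_apply]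
  split_ifs
  · exact le_rfl
  · exact ENNReal.tsum_le_tsum fun s => mul_le_mul_right (h _) _

/-- The probability of never visiting `S`, as a function of the starting point, is subharmonic and
vanishes on `S`; if it vanishes everywhere, then `S` is recurrent. -/
theorem exists_avoidance_function (S : Set G) :
    ∃ q : G → ℝ, (∀ g, 0 ≤ q g) ∧ (∀ g, q g ≤ 1) ∧ (∀ g ∈ S, q g = 0) ∧
      (∀ g, q g ≤ stepMean hfin q g) ∧ ((∀ g, q g = 0) → IsRecurrentSet μ S) := by
  classical
  set Q : ℕ → G → ENNReal := fun n => (killedStep μ S)^[n] fun _ => 1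
  have hanti : Antitone Q := by
    refine (killedStep_mono S).antitone_iterate_of_map_le fun g => ?_
    rw [killedStep_apply]
    split_ifs
    · exact bot_le
    · simp
  have hle : ∀ n g, Q n g ≤ 1 := fun n g => hanti (Nat.zero_le n) g
  set q : G → ENNReal := fun g => ⨅ n, Q n g
  have hq : ∀ g, Tendsto (fun n => Q n g) atTop (𝓝 (q g)) := fun g =>
    tendsto_atTop_iInf fun i j hij => hanti hij g
  have hq1 : ∀ g, q g ≤ 1 := fun g => iInf_le_of_le 0 (hle 0 g)
  have hqtop : ∀ g, q g ≠ ⊤ := fun g => ne_top_of_le_ne_top ENNReal.one_ne_top (hq1 g)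
  -- The limit passes through the recursion because the sum over steps is finite.
  have hfix : ∀ g, q g = if g ∈ S then 0 else ∑ s ∈ hfin.toFinset, μ s * q (g * s) := by
    intro g
    refine tendsto_nhds_unique ((tendsto_add_atTop_iff_nat 1).2 (hq g)) ?_
    have : ∀ n, Q (n + 1) g = if g ∈ S then 0 else ∑ s ∈ hfin.toFinset, μ s * Q n (g * s) :=
      fun n => by
        rw [← killedStep_eq_sum hfin]
        exact congrFun (Function.iterate_succ_apply' _ _ _) g
    simp_rw [this]
    split_ifs
    · exact tendsto_const_nhds
    · exact tendsto_finsetSum _ fun s _ =>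
        ENNReal.Tendsto.const_mul (hq _) (Or.inr (μ.apply_ne_top s))
  refine ⟨fun g => (q g).toReal, fun g => ENNReal.toReal_nonneg, fun g => ?_, fun g hg => ?_,
    fun g => ?_, fun h => ?_⟩
  · exact ENNReal.toReal_le_of_le_ofReal zero_le_one (by simpa using hq1 g)
  · beta_reduce
    rw [hfix, if_pos hg, ENNReal.toReal_zero]
  · beta_reduce
    rw [hfix, stepMean]
    split_ifs
    · exact Finset.sum_nonneg fun s _ => mul_nonneg ENNReal.toReal_nonneg ENNReal.toReal_nonneg
    · rw [ENNReal.toReal_sum fun s _ => ENNReal.mul_ne_top (μ.apply_ne_top s) (hqtop _)]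
      simp_rw [ENNReal.toReal_mul]
      exact le_rfl
  · refine isRecurrentSet_of_tendsto μ hfin S fun g => ?_
    have h0 : q g = 0 := by simpa [ENNReal.toReal_eq_zero_iff, hqtop] using h g
    rw [← h0]
    exact hq g

variable {lv : G → ℤ}

/-- A strictly concave function of the distance to the boundary, vanishing at zero. -/
noncomputable def concaveBarrier (k : ℤ) : ℝ := k + 1 - (2 : ℝ) ^ (-k)

/-- The linear part cancels, and `2^(-(k-1)) + 2^(-(k+1))` exceeds `2 * 2^(-k)` by `2^(-k) / 2`. -/
theorem concaveBarrier_add_sub {k l : ℤ} (hl : |l| ≤ 1) :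
    concaveBarrier (k - l) + concaveBarrier (k + l) =
      2 * concaveBarrier k - if l = 0 then 0 else (2 : ℝ) ^ (-k) / 2 := by
  have h2 : (2 : ℝ) ≠ 0 := two_ne_zero
  have := abs_le.1 hl
  obtain rfl | rfl | rfl : l = 1 ∨ l = 0 ∨ l = -1 := by omega
  · simp only [concaveBarrier, show -(k - 1) = -k + 1 by ring, show -(k + 1) = -k - 1 by ring,
      zpow_add_one₀ h2, zpow_sub_one₀ h2]
    push_cast
    norm_num
    ring
  · simp [two_mul]
  · simp only [concaveBarrier, show -(k - -1) = -k - 1 by ring, show -(k + -1) = -k + 1 by ring,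
      zpow_add_one₀ h2, zpow_sub_one₀ h2]
    push_cast
    norm_num
    ring

/-- Average over `s` and `s⁻¹` and keep the deficit of the single step `t`. It depends only on the
distance to the boundary, hence is uniform on strips. -/
theorem IsSymmetric.stepMean_concaveBarrier_le (hμ : IsSymmetric μ)
    (hlv : ∀ x y, lv (x * y) = lv x + lv y) (hstep : ∀ s ∈ μ.support, |lv s| ≤ 1)
    {t : G} (ht : t ∈ μ.support) (ht1 : lv t ≠ 0) (m : ℤ) (g : G) :
    stepMean hfin (fun g => concaveBarrier (m - lv g)) g ≤
      concaveBarrier (m - lv g) - (μ t).toReal * (2 : ℝ) ^ (-(m - lv g)) / 4 := by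
  have lv_one : lv 1 = 0 := by simpa using hlv 1 1
  have lv_inv : ∀ x, lv x⁻¹ = - lv x := fun x => by
    have := hlv x x⁻¹
    rw [mul_inv_cancel, lv_one] at this
    omega
  set k := m - lv g
  have h1 : stepMean hfin (fun g => concaveBarrier (m - lv g)) g =
      ∑ s ∈ hfin.toFinset, (μ s).toReal * concaveBarrier (k - lv s) := by
    simp only [stepMean, hlv, k, sub_add_eq_sub_sub]
  have h2 : stepMean hfin (fun g => concaveBarrier (m - lv g)) g =
      ∑ s ∈ hfin.toFinset, (μ s).toReal * concaveBarrier (k + lv s) := by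
    rw [h1]
    refine Finset.sum_equiv (Equiv.inv G) (fun s => ?_) fun s _ => ?_
    · simp [hμ s]
    · simp [hμ s, lv_inv, sub_eq_add_neg]
  have h3 : stepMean hfin (fun g => concaveBarrier (m - lv g)) g +
      stepMean hfin (fun g => concaveBarrier (m - lv g)) g =
      ∑ s ∈ hfin.toFinset, (μ s).toReal *
        (2 * concaveBarrier k - if lv s = 0 then 0 else (2 : ℝ) ^ (-k) / 2) := by
    nth_rewrite 1 [h1]
    rw [h2, ← Finset.sum_add_distrib]
    refine Finset.sum_congr rfl fun s hs => ?_
    rw [← mul_add, concaveBarrier_add_sub (hstep s (by simpa using hs))]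
  have h4 : ∑ s ∈ hfin.toFinset, (μ s).toReal *
        (2 * concaveBarrier k - if lv s = 0 then 0 else (2 : ℝ) ^ (-k) / 2) =
      2 * concaveBarrier k - ∑ s ∈ hfin.toFinset, (μ s).toReal *
        if lv s = 0 then 0 else (2 : ℝ) ^ (-k) / 2 := by
    simp_rw [mul_sub]
    rw [Finset.sum_sub_distrib, ← Finset.sum_mul, sum_toReal_eq_one, one_mul]
  have h5 : (μ t).toReal * ((2 : ℝ) ^ (-k) / 2) ≤ ∑ s ∈ hfin.toFinset, (μ s).toReal *
        if lv s = 0 then 0 else (2 : ℝ) ^ (-k) / 2 := by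
    have := Finset.single_le_sum (s := hfin.toFinset) (f := fun s => (μ s).toReal *
        if lv s = 0 then 0 else (2 : ℝ) ^ (-k) / 2) (fun s _ => mul_nonneg ENNReal.toReal_nonneg
        (by split_ifs <;> positivity)) (by simpa using ht : t ∈ hfin.toFinset)
    simpa [ht1] using this
  linarith

/-- The maximum principle for bounded subharmonic functions on a half-space, for a walk whose level
is a recurrent walk on the integers. -/
theorem IsSymmetric.nonpos_of_le_stepMean (hμ : IsSymmetric μ)
    (hlv : ∀ x y, lv (x * y) = lv x + lv y) (hstep : ∀ s ∈ μ.support, |lv s| ≤ 1)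
    {t : G} (ht : t ∈ μ.support) (ht1 : lv t ≠ 0) {m : ℤ} {D : Set G} (hD : ∀ g ∈ D, lv g ≤ m)
    (hDstep : ∀ g ∈ D, lv g < m → ∀ s ∈ μ.support, g * s ∈ D) {u : G → ℝ} {B : ℝ}
    (hB : ∀ g ∈ D, u g ≤ B) (hu : ∀ g ∈ D, lv g < m → u g ≤ stepMean hfin u g)
    (hbd : ∀ g ∈ D, lv g = m → u g ≤ 0) {g : G} (hg : g ∈ D) : u g ≤ 0 := by
  have hh : ∀ k : ℤ, 0 ≤ k → (k : ℝ) ≤ concaveBarrier k := by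
    intro k hk
    have : (2 : ℝ) ^ (-k) ≤ 1 := zpow_le_one_of_nonpos₀ one_le_two (by omega)
    simp only [concaveBarrier]
    linarith
  -- The supremum of `F` over `D` need not be attained. Positivity confines near-maximizers to
  -- distance at most `A` from the boundary, where the barrier's deficit is at least `δ`; a point
  -- within `ε * δ` of the supremum then contradicts averaging.
  have main : ∀ ε > 0, ∀ g ∈ D, u g - ε * concaveBarrier (m - lv g) ≤ 0 := by
    intro ε hε g₀ hg₀
    by_contra! hpos
    set F : G → ℝ := fun g => u g - ε * concaveBarrier (m - lv g)
    have hFB : ∀ g ∈ D, F g ≤ B - ε * (m - lv g : ℤ) := fun g hg =>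
      sub_le_sub (hB g hg) (mul_le_mul_of_nonneg_left (hh _ (by have := hD g hg; omega)) hε.le)
    have hFB' : ∀ g ∈ D, F g ≤ B := fun g hg => (hFB g hg).trans <| sub_le_self _ <|
      mul_nonneg hε.le (by exact_mod_cast sub_nonneg.2 (hD g hg))
    have hbdd : BddAbove (F '' D) := ⟨B, by rintro _ ⟨g, hg, rfl⟩; exact hFB' g hg⟩
    set M := sSup (F '' D)
    have hM : 0 < M := hpos.trans_le (le_csSup hbdd ⟨g₀, hg₀, rfl⟩)
    obtain ⟨A, hA⟩ := exists_nat_ge (B / ε)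
    have hp : 0 < (μ t).toReal := ENNReal.toReal_pos ht (μ.apply_ne_top t)
    set δ : ℝ := (μ t).toReal * (2 : ℝ) ^ (-(A : ℤ)) / 4
    have hδ : 0 < δ := by positivity
    obtain ⟨_, ⟨g, hg, rfl⟩, hlt⟩ := exists_lt_of_lt_csSup (b := max 0 (M - ε * δ))
      (⟨F g₀, g₀, hg₀, rfl⟩ : (F '' D).Nonempty) (max_lt hM (by nlinarith : M - ε * δ < M))
    obtain ⟨hlt1, hlt2⟩ := max_lt_iff.1 hlt
    have hkA : m - lv g ≤ A := by
      by_contra! h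
      have h1 : (A : ℝ) ≤ (m - lv g : ℤ) := by exact_mod_cast h.le
      have h2 := hFB g hg
      have h3 : B ≤ ε * (m - lv g : ℤ) := by
        rw [mul_comm, ← div_le_iff₀ hε]
        exact hA.trans h1
      linarith
    have hlvm : lv g < m := by
      refine lt_of_le_of_ne (hD g hg) fun h => ?_
      have h1 := hbd g hg h
      have : F g = u g := by simp [F, h, concaveBarrier]
      linarith
    have h1 := hu g hg hlvm
    have h2 := hμ.stepMean_concaveBarrier_le hfin hlv hstep ht ht1 m g
    have h3 : δ ≤ (μ t).toReal * (2 : ℝ) ^ (-(m - lv g)) / 4 := by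
      have : (2 : ℝ) ^ (-(A : ℤ)) ≤ (2 : ℝ) ^ (-(m - lv g)) :=
        zpow_le_zpow_right₀ one_le_two (by omega)
      simp only [δ]
      gcongr
    have h4 : stepMean hfin F g ≤ M := stepMean_le_of_le hfin fun s hs =>
      le_csSup hbdd ⟨_, hDstep g hg hlvm s hs, rfl⟩
    have h5 : stepMean hfin F g = stepMean hfin u g -
        ε * stepMean hfin (fun g => concaveBarrier (m - lv g)) g := by
      rw [← stepMean_const_mul, ← stepMean_sub]
    have h6 : F g = u g - ε * concaveBarrier (m - lv g) := rfl
    nlinarith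
  refine le_of_forall_pos_le_add fun ε hε => ?_
  have h0 : 0 ≤ concaveBarrier (m - lv g) :=
    le_trans (by exact_mod_cast sub_nonneg.2 (hD g hg)) (hh _ (sub_nonneg.2 (hD g hg)))
  have h1 := main (ε / (concaveBarrier (m - lv g) + 1)) (by positivity) g hg
  have h2 : ε / (concaveBarrier (m - lv g) + 1) * concaveBarrier (m - lv g) ≤ ε := by
    rw [div_mul_eq_mul_div, div_le_iff₀ (by positivity)]
    nlinarith
  linarith

end stepMean

end RandomWalk

/-! ### Recurrence of the union of cleared sets -/

namespace RandomWalk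

theorem tendsto_prod_one_sub_zero {x : ℕ → ℝ} (h0 : ∀ i, 0 ≤ x i) (h1 : ∀ i, x i ≤ 1)
    (hx : ¬ Summable x) : Tendsto (fun n => ∏ i ∈ Finset.range n, (1 - x i)) atTop (𝓝 0) := by
  have h2 : Tendsto (fun n => Real.exp (-∑ i ∈ Finset.range n, x i)) atTop (𝓝 0) :=
    Real.tendsto_exp_neg_atTop_nhds_zero.comp
      ((not_summable_iff_tendsto_nat_atTop_of_nonneg h0).1 hx)
  refine squeeze_zero (fun n => Finset.prod_nonneg fun i _ => sub_nonneg.2 (h1 i)) (fun n => ?_) h2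
  rw [← Finset.sum_neg_distrib, Real.exp_sum]
  refine Finset.prod_le_prod (fun i _ => sub_nonneg.2 (h1 i)) fun i _ => ?_
  have := Real.add_one_le_exp (-x i)
  linarith

variable {H Q : Type*} [Group H] [Group Q] {lev : Q → ℤ}

theorem exists_isBelow (g : restrictedWreathProduct H Q) : ∃ N : ℕ, IsBelow lev N g := by
  obtain ⟨B, hB⟩ := ((g.2 : (Function.mulSupport (lamps g)).Finite).image lev).bddAbove
  refine ⟨(max B (lev (site g))).toNat, by simp, fun x hx => ?_⟩
  by_contra hne
  have := hB ⟨x, hne, rfl⟩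
  omega

theorem lamps_mul_move (g : restrictedWreathProduct H Q) (y x : Q) :
    lamps (g * move y) x = lamps g x := by
  simp [lamps_mul]

/-- Let `q` be the probability of never visiting the set. From a state at height `A j` with no lamp
lit above, the chance to reach height `A (j + 1)` along the line of powers of `t`, with the lamps
above `A j` still off, is at least `θ ^ gap`. So `q` is at most `1 - θ ^ gap` times its bound over
the states of the same kind at `A (j + 1)`. The resulting infinite product vanishes. -/
theorem isRecurrentSet_iUnion_clearedSet (hlev : ∀ x y, lev (x * y) = lev x + lev y)
    {η : PMF H} {ρ : PMF Q} (hρ : ∀ s ∈ ρ.support, |lev s| ≤ 1)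
    (hμ : IsSymmetric (switchWalkSwitch η ρ)) (hfin : (switchWalkSwitch η ρ).support.Finite)
    {t : Q} (ht1 : lev t = 1) {b θ : ℝ} (hb0 : 0 < b)
    (hb : b ≤ (switchWalkSwitch η ρ (move t)).toReal) (hθ0 : 0 < θ) (hθ1 : θ ≤ 1)
    (hθb : θ ≤ b * (1 + θ ^ 2)) {A : ℕ → ℕ} (hA : StrictMono A)
    (hsum : ¬ Summable fun j => θ ^ (A (j + 1) - A j)) :
    IsRecurrentSet (switchWalkSwitch η ρ) (⋃ j, clearedSet H lev (A j) (A (j + 1))) := by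
  classical
  set μ := switchWalkSwitch η ρ
  have lev_one : lev 1 = 0 := by simpa using hlev 1 1
  have lev_inv : ∀ x, lev x⁻¹ = - lev x := fun x => by
    have := hlev x x⁻¹
    rw [mul_inv_cancel, lev_one] at this
    omega
  set lv : restrictedWreathProduct H Q → ℤ := fun g => lev (site g)
  have hlv : ∀ x y, lv (x * y) = lv x + lv y := fun x y => hlev _ _
  have hstep : ∀ s ∈ μ.support, |lv s| ≤ 1 := by
    intro g hg
    obtain ⟨h, -, s, hs, h', -, rfl⟩ := mem_support_switchWalkSwitch.1 hg
    simpa [lv] using hρ s hs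
  have htμ : move t ∈ μ.support := by
    intro h
    rw [h] at hb
    exact absurd hb0 (not_lt.2 (by simpa using hb))
  have htlv : lv (move t) ≠ 0 := by simp [lv, ht1]
  have hmi : lv (move t⁻¹) = -1 := by simp only [lv, site_move, lev_inv, ht1]
  have hDstep : ∀ m : ℤ, ∀ g ∈ {g | IsBelow lev m g}, lv g < m → ∀ s ∈ μ.support,
      g * s ∈ {g | IsBelow lev m g} := by
    intro m g hg hlt s hs
    have h1 := (abs_le.1 (hstep s hs)).2
    obtain ⟨h, -, s, -, h', -, rfl⟩ := mem_support_switchWalkSwitch.1 hs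
    refine IsBelow.mul_swsStep hg le_rfl ?_ h h'
    simp only [lv, site_swsStep] at h1 hlt
    rw [hlev]
    omega
  obtain ⟨q, hq0, hq1, hqS, hq, hrec⟩ := exists_avoidance_function hfin
    (⋃ j, clearedSet H lev (A j) (A (j + 1)))
  refine hrec ?_
  have hmax : ∀ (m : ℤ) (u : restrictedWreathProduct H Q → ℝ) (B : ℝ),
      (∀ g, IsBelow lev m g → u g ≤ B) →
      (∀ g, IsBelow lev m g → lv g < m → u g ≤ stepMean hfin u g) →
      (∀ g, IsBelow lev m g → lv g = m → u g ≤ 0) → ∀ g, IsBelow lev m g → u g ≤ 0 :=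
    fun m u B h1 h2 h3 g hg => hμ.nonpos_of_le_stepMean hfin hlv hstep htμ htlv
      (D := {g | IsBelow lev m g}) (fun g hg => hg.1) (hDstep m) h1 h2 h3 hg
  have hind : ∀ j : ℕ, ∀ B : ℝ, 0 ≤ B →
      (∀ g, IsBelow lev (A (j + 1)) g → lv g = A (j + 1) → q g ≤ B) →
      ∀ g, IsBelow lev (A j) g → lv g = A j → q g ≤ (1 - θ ^ (A (j + 1) - A j)) * B := by
    intro j B hB0 hB g₀ hg₀ hlv₀
    have hlt : A j < A (j + 1) := hA j.lt_succ_self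
    -- Supported on the line through `g₀`, with value 1 at height `A (j + 1)`; `θ ≤ b * (1 + θ ^ 2)`
    -- makes it subharmonic. It plays the part of a lower bound for the probability of success.
    set w : restrictedWreathProduct H Q → ℝ := fun g =>
      if g = g₀ * move (t ^ (lv g - A j)) then θ ^ ((A (j + 1) : ℤ) - lv g) else 0
    have hw0 : ∀ g, 0 ≤ w g := fun g => by
      simp only [w]
      split_ifs <;> positivity
    have hw1 : ∀ g, lv g ≤ A (j + 1) → w g ≤ 1 := fun g hg => by
      simp only [w]
      split_ifs
      · obtain ⟨k, hk⟩ := Int.eq_ofNat_of_zero_le (sub_nonneg.2 hg)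
        rw [hk, zpow_natCast]
        exact pow_le_one₀ hθ0.le hθ1
      · exact zero_le_one
    have hw : ∀ g, w g ≤ stepMean hfin w g := by
      intro g
      by_cases hg : g = g₀ * move (t ^ (lv g - A j))
      · have h1 : w g = θ ^ ((A (j + 1) : ℤ) - lv g) := if_pos hg
        have h2 : w (g * move t) = θ ^ ((A (j + 1) : ℤ) - lv g - 1) := by
          have : lv (g * move t) = lv g + 1 := by simp [hlv, lv, ht1]
          simp only [w]
          rw [this, if_pos, sub_add_eq_sub_sub]
          conv_lhs => rw [hg]
          rw [mul_assoc, ← map_mul, ← zpow_add_one]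
          congr 3
          ring
        have h3 : w (g * move t⁻¹) = θ ^ ((A (j + 1) : ℤ) - lv g + 1) := by
          have : lv (g * move t⁻¹) = lv g - 1 := by
            rw [hlv, hmi, sub_eq_add_neg]
          simp only [w]
          rw [this, if_pos, sub_sub_eq_add_sub, add_sub_right_comm]
          conv_lhs => rw [hg]
          rw [mul_assoc, ← map_mul, ← zpow_sub_one]
          congr 3
          ring
        have htinv : μ (move t⁻¹) = μ (move t) := by rw [map_inv, hμ]
        have hne : (move t : restrictedWreathProduct H Q) ≠ move t⁻¹ := by
          intro h
          have := congrArg lv h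
          rw [hmi] at this
          simp [lv, ht1] at this
        have h4 : (μ (move t)).toReal * w (g * move t) +
            (μ (move t⁻¹)).toReal * w (g * move t⁻¹) ≤ stepMean hfin w g := by
          rw [stepMean, ← Finset.sum_pair (f := fun s => (μ s).toReal * w (g * s)) hne]
          refine Finset.sum_le_sum_of_subset_of_nonneg ?_ fun s _ _ =>
            mul_nonneg ENNReal.toReal_nonneg (hw0 _)
          intro s hs
          rw [Set.Finite.mem_toFinset]
          rcases Finset.mem_insert.1 hs with rfl | hs
          · exact htμ
          · rw [Finset.mem_singleton.1 hs, PMF.mem_support_iff, htinv]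
            exact htμ
        refine le_trans ?_ h4
        rw [htinv, ← mul_add, h1, h2, h3, zpow_add_one₀ hθ0.ne', zpow_sub_one₀ hθ0.ne']
        set P := θ ^ ((A (j + 1) : ℤ) - lv g)
        have hP : 0 < P := by positivity
        have h5 : P ≤ b * (P * θ⁻¹ + P * θ) := by
          have : b * (P * θ⁻¹ + P * θ) = P * θ⁻¹ * (b * (1 + θ ^ 2)) := by
            field_simp
          rw [this]
          calc P = P * θ⁻¹ * θ := by field_simp
            _ ≤ _ := by gcongr
        exact h5.trans (by gcongr)
      · have : w g = 0 := if_neg hg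
        rw [this]
        exact Finset.sum_nonneg fun s _ => mul_nonneg ENNReal.toReal_nonneg (hw0 _)
    -- On the top height, `q ≤ B` off the line, while on the line the state lies in the set, so `q =
    -- 0` and `w = 1`.
    have hu := hmax (A (j + 1)) (fun g => q g - B * (1 - w g)) 1 (fun g hg => ?_)
      (fun g hg hlt => ?_) (fun g hg hlv' => ?_) g₀
      ⟨hg₀.1.trans (by exact_mod_cast hlt.le), fun x hx =>
        hg₀.2 x (lt_trans (by exact_mod_cast hlt) hx)⟩
    · have hw₀ : w g₀ = θ ^ (A (j + 1) - A j) := by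
        simp only [w]
        rw [hlv₀, sub_self, zpow_zero, map_one, mul_one, if_pos rfl, ← zpow_natCast,
          Nat.cast_sub hlt.le]
      rw [hw₀] at hu
      linarith
    · have h1 := hw1 g hg.1
      have h2 := mul_nonneg hB0 (sub_nonneg.2 h1)
      have h3 := hq1 g
      linarith
    · rw [stepMean_sub, stepMean_const_mul, stepMean_sub, stepMean_const]
      have h1 := mul_le_mul_of_nonneg_left (hw g) hB0
      have h2 := hq g
      linarith
    · by_cases hg' : g = g₀ * move (t ^ (lv g - A j))
      · have hwg : w g = 1 := by
          simp only [w]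
          rw [if_pos hg', hlv', sub_self, zpow_zero]
        have hqg : q g = 0 := by
          refine hqS g (Set.mem_iUnion.2 ⟨j, hlv', fun x hx => ?_⟩)
          rw [hg', lamps_mul_move]
          exact hg₀.2 x hx
        rw [hwg, hqg]
        simp
      · have hwg : w g = 0 := if_neg hg'
        rw [hwg]
        have := hB g hg hlv'
        linarith
  have hprod : ∀ L j : ℕ, ∀ g, IsBelow lev (A j) g → lv g = A j →
      q g ≤ ∏ i ∈ Finset.range L, (1 - θ ^ (A (i + j + 1) - A (i + j))) := by
    intro L
    induction L with
    | zero => exact fun j g _ _ => by simpa using hq1 g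
    | succ L ih =>
      intro j g hg hlg
      rw [Finset.prod_range_succ', zero_add, mul_comm]
      refine hind j _ (Finset.prod_nonneg fun i _ =>
        sub_nonneg.2 (pow_le_one₀ hθ0.le hθ1)) (fun g' hg' hlg' => ?_) g hg hlg
      refine (ih (j + 1) g' hg' hlg').trans (le_of_eq ?_)
      refine Finset.prod_congr rfl fun i _ => ?_
      rw [show i + (j + 1) = i + 1 + j by ring]
  have hrecord : ∀ j : ℕ, ∀ g, IsBelow lev (A j) g → lv g = A j → q g ≤ 0 := by
    intro j g hg hlg
    refine ge_of_tendsto' (tendsto_prod_one_sub_zero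
      (x := fun i => θ ^ (A (i + j + 1) - A (i + j))) (fun i => by positivity)
      (fun i => pow_le_one₀ hθ0.le hθ1) ?_) fun L => hprod L j g hg hlg
    intro h
    exact hsum ((summable_nat_add_iff (f := fun i => θ ^ (A (i + 1) - A i)) j).1 h)
  intro g
  obtain ⟨N, hN⟩ := exists_isBelow (lev := lev) g
  -- Every element lies below some height `A N`, where `q` vanishes on the top, so the maximum
  -- principle finishes.
  have hNA : (N : ℤ) ≤ A N := by exact_mod_cast hA.le_apply
  exact le_antisymm (hmax (A N) q 1 (fun g _ => hq1 g) (fun g _ _ => hq g)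
    (fun g hg hlg => hrecord N g hg hlg) g
    ⟨hN.1.trans hNA, fun x hx => hN.2 x (hNA.trans_lt hx)⟩) (hq0 g)

end RandomWalk

/-! ### Mixtures, symmetry and generation -/

/-- The convex combination `ε a + (1 - ε) b`. -/
noncomputable def PMF.mix {α : Type*} (ε : ℝ) (h0 : 0 ≤ ε) (h1 : ε ≤ 1) (a b : PMF α) : PMF α :=
  ⟨fun x => ENNReal.ofReal ε * a x + ENNReal.ofReal (1 - ε) * b x, by
    rw [ENNReal.summable.hasSum_iff, ENNReal.tsum_add, ENNReal.tsum_mul_left,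
      ENNReal.tsum_mul_left, PMF.tsum_coe, PMF.tsum_coe, mul_one, mul_one,
      ← ENNReal.ofReal_add h0 (sub_nonneg.2 h1)]
    simp⟩

theorem PMF.mix_apply {α : Type*} {ε : ℝ} (h0 : 0 ≤ ε) (h1 : ε ≤ 1) (a b : PMF α) (x : α) :
    PMF.mix ε h0 h1 a b x = ENNReal.ofReal ε * a x + ENNReal.ofReal (1 - ε) * b x := rfl

theorem PMF.support_mix {α : Type*} {ε : ℝ} (h0 : 0 < ε) (h1 : ε < 1) (a b : PMF α) :
    (PMF.mix ε h0.le h1.le a b).support = a.support ∪ b.support := by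
  ext x
  simp only [PMF.mem_support_iff, PMF.mix_apply, Set.mem_union, ne_eq, add_eq_zero, mul_eq_zero,
    ENNReal.ofReal_eq_zero, not_le.2 h0, not_le.2 (sub_pos.2 h1), false_or]
  tauto

namespace RandomWalk

theorem isSymmetric_mix {G : Type*} [Group G] {ε : ℝ} (h0 : 0 ≤ ε) (h1 : ε ≤ 1) {a b : PMF G}
    (ha : IsSymmetric a) (hb : IsSymmetric b) : IsSymmetric (PMF.mix ε h0 h1 a b) := fun g => by
  rw [PMF.mix_apply, PMF.mix_apply, ha, hb]

theorem isSymmetric_uniformOfFinset {G : Type*} [Group G] {s : Finset G} (hs : s.Nonempty)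
    (h : ∀ g ∈ s, g⁻¹ ∈ s) : IsSymmetric (PMF.uniformOfFinset s hs) := fun g => by
  classical
  have : g⁻¹ ∈ s ↔ g ∈ s := ⟨fun hg => by simpa using h _ hg, h g⟩
  simp only [PMF.uniformOfFinset_apply, this]

variable {H Q : Type*} [Group H] [Group Q]

/-- Inversion reverses the step and exchanges the two switches, which are independent with the same
law. -/
theorem isSymmetric_switchWalkSwitch {η : PMF H} {ρ : PMF Q} (hη : IsSymmetric η)
    (hρ : IsSymmetric ρ) : IsSymmetric (switchWalkSwitch η ρ) := by
  classical
  have key : ∀ g, switchWalkSwitch η ρ g =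
      ∑' h, η h * ∑' s, ρ s * ∑' h', η h' * if swsStep h s h' = g then 1 else 0 := fun g => by
    rw [← tsum_switchWalkSwitch_mul η ρ fun x => if x = g then 1 else 0]
    simp
  intro g
  rw [key, key]
  calc _ = ∑' h, η h * ∑' s, ρ s * ∑' h', η h' * if swsStep h' s h = g then 1 else 0 := by
        rw [← hη.tsum_inv]
        refine tsum_congr fun h => ?_
        rw [← hρ.tsum_inv]
        congr 1
        refine tsum_congr fun s => ?_
        rw [← hη.tsum_inv]
        congr 1
        refine tsum_congr fun h' => ?_
        simp only [← swsStep_inv, inv_inj]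
    _ = _ := by
        simp_rw [← ENNReal.tsum_mul_left]
        calc _ = ∑' h, ∑' h', ∑' s, η h * (ρ s * (η h' * if swsStep h' s h = g then 1 else 0)) :=
              tsum_congr fun h => ENNReal.tsum_comm
          _ = ∑' h', ∑' h, ∑' s, η h * (ρ s * (η h' * if swsStep h' s h = g then 1 else 0)) :=
              ENNReal.tsum_comm
          _ = ∑' h', ∑' s, ∑' h, η h * (ρ s * (η h' * if swsStep h' s h = g then 1 else 0)) :=
              tsum_congr fun h => ENNReal.tsum_comm
          _ = _ := tsum_congr fun h' => tsum_congr fun s => tsum_congr fun h => by ring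

theorem le_switchWalkSwitch (η : PMF H) (ρ : PMF Q) (t : Q) :
    η 1 * ρ t * η 1 ≤ switchWalkSwitch η ρ (move t) := by
  classical
  have h1 : (swsStep 1 t 1 : restrictedWreathProduct H Q) = move t := by simp [swsStep]
  have h2 : switchWalkSwitch η ρ (move t) = ∑' h, η h * ∑' s, ρ s * ∑' h', η h' *
      if swsStep h s h' = move t then 1 else 0 := by
    rw [← tsum_switchWalkSwitch_mul η ρ fun x => if x = move t then 1 else 0]
    simp
  rw [h2, mul_assoc]
  refine le_trans (mul_le_mul_right (le_trans (mul_le_mul_right ?_ _) (ENNReal.le_tsum t)) _)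
    (ENNReal.le_tsum 1)
  exact le_trans (by simp [h1]) (ENNReal.le_tsum 1)

theorem finite_support_switchWalkSwitch {η : PMF H} {ρ : PMF Q} (hη : η.support.Finite)
    (hρ : ρ.support.Finite) : (switchWalkSwitch η ρ).support.Finite := by
  refine ((hη.prod (hρ.prod hη)).image fun p => swsStep p.1 p.2.1 p.2.2).subset fun g hg => ?_
  obtain ⟨h, hh, s, hs, h', hh', rfl⟩ := mem_support_switchWalkSwitch.1 hg
  exact ⟨(h, s, h'), ⟨hh, hs, hh'⟩, rfl⟩

theorem support_switchWalkSwitch_congr {η η' : PMF H} {ρ ρ' : PMF Q} (hη : η.support = η'.support)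
    (hρ : ρ.support = ρ'.support) :
    (switchWalkSwitch η ρ).support = (switchWalkSwitch η' ρ').support := by
  ext g
  rw [mem_support_switchWalkSwitch, mem_support_switchWalkSwitch, hη, hρ]

/-- Induction on the number of lit lamps, putting one out with a conjugate of `lampAt` by a move. -/
theorem mem_closure_lampAt_move (K : Subgroup (restrictedWreathProduct H Q))
    (hl : ∀ h, lampAt h ∈ K) (hm : ∀ y, move y ∈ K) (g : restrictedWreathProduct H Q) : g ∈ K := by
  classical
  have key : ∀ n (g : restrictedWreathProduct H Q) (hg : (Function.mulSupport (lamps g)).Finite),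
      hg.toFinset.card = n → g ∈ K := by
    intro n
    induction n with
    | zero =>
      intro g hg hn
      have h1 : ∀ x, lamps g x = 1 := fun x => by
        by_contra h
        have : x ∈ hg.toFinset := by simpa using h
        simp [Finset.card_eq_zero.1 hn] at this
      have : g = move (site g) := ext_iff'.2 ⟨fun x => by simp [h1], by simp⟩
      rw [this]
      exact hm _
    | succ n ih =>
      intro g hg hn
      obtain ⟨x, hx⟩ : hg.toFinset.Nonempty := Finset.card_pos.1 (by omega)
      set c := move x * lampAt (lamps g x)⁻¹ * (move x)⁻¹
      have hc : c ∈ K := K.mul_mem (K.mul_mem (hm _) (hl _)) (K.inv_mem (hm _))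
      have hlc : ∀ z, lamps (c * g) z = if z = x then 1 else lamps g z := by
        intro z
        have h2 : lamps c z = if z = x then (lamps g x)⁻¹ else 1 := by
          have : c = move x * lampAt (lamps g x)⁻¹ * move x⁻¹ := by simp only [c, map_inv]
          rw [this, lamps_mul, lamps_mul]
          simp only [lamps_move, site_move, Pi.one_apply, mul_one, one_mul, lamps_lampAt]
          by_cases hz : z = x
          · simp [hz]
          · rw [if_neg hz, Pi.mulSingle_eq_of_ne fun h => hz (inv_mul_eq_one.1 h).symm]
        have h3 : (site c)⁻¹ * z = z := by simp [c, site_mul, ← map_inv]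
        rw [lamps_mul, h2, h3]
        split_ifs with hz
        · rw [hz, inv_mul_cancel]
        · rw [one_mul]
      have hfin : (Function.mulSupport (lamps (c * g))).Finite := (c * g).2
      have hcard : hfin.toFinset = hg.toFinset.erase x := by
        ext z
        simp only [Set.Finite.mem_toFinset, Function.mem_mulSupport, hlc, Finset.mem_erase]
        by_cases hz : z = x <;> simp [hz]
      have := ih (c * g) hfin (by rw [hcard, Finset.card_erase_of_mem hx, hn]; rfl)
      exact (K.mul_mem_cancel_left hc).1 this
  exact key _ g g.2 rfl

/-- Trivial switches are allowed, so pure moves occur in the support; cancelling them leaves pure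
switches. -/
theorem closure_support_switchWalkSwitch {η : PMF H} {ρ : PMF Q} (h1 : (1 : H) ∈ η.support)
    (hη : Subgroup.closure η.support = ⊤) (hρ : Subgroup.closure ρ.support = ⊤) :
    Subgroup.closure (switchWalkSwitch η ρ).support = ⊤ := by
  set K := Subgroup.closure (switchWalkSwitch η ρ).support
  have hmem : ∀ h ∈ η.support, ∀ s ∈ ρ.support, swsStep h s 1 ∈ K := fun h hh s hs =>
    Subgroup.subset_closure (mem_support_switchWalkSwitch.2 ⟨h, hh, s, hs, 1, h1, rfl⟩)
  have hm : ∀ s ∈ ρ.support, move s ∈ K := fun s hs => by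
    simpa [swsStep] using hmem 1 h1 s hs
  have hm' : ∀ y, move y ∈ K := fun y => by
    have : Subgroup.closure ρ.support ≤ K.comap move := (Subgroup.closure_le _).2 hm
    rw [hρ] at this
    exact this (Subgroup.mem_top y)
  have hl : ∀ h, lampAt h ∈ K := fun h => by
    have : Subgroup.closure η.support ≤ K.comap lampAt := by
      refine (Subgroup.closure_le _).2 fun h hh => ?_
      obtain ⟨s, hs⟩ := ρ.support_nonempty
      have := K.mul_mem (hmem h hh s hs) (K.inv_mem (hm s hs))
      simpa [swsStep] using this
    rw [hη] at this
    exact this (Subgroup.mem_top h)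
  exact (Subgroup.eq_top_iff' K).2 (mem_closure_lampAt_move K hl hm')

end RandomWalk

/-! ### The two laws and the choice of constants -/

namespace RandomWalk

variable {H Q : Type*} [Group H] [Group Q]

/-- The lamp is left alone with probability `1 - ε`. -/
noncomputable def lazyLampLaw (B : Finset H) (hB : B.Nonempty) (ε : ℝ) (h0 : 0 < ε) (h1 : ε < 1) :
    PMF H :=
  PMF.mix ε h0.le h1.le (PMF.uniformOfFinset B hB) (PMF.pure 1)

open Classical in
/-- With probability `1 - ε`, a fair step by `t` or `t⁻¹`; otherwise a uniform step in `E`. -/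
noncomputable def biasedStepLaw (E : Finset Q) (t : Q) (ht : t ∈ E) (ε : ℝ) (h0 : 0 < ε)
    (h1 : ε < 1) : PMF Q :=
  PMF.mix ε h0.le h1.le (PMF.uniformOfFinset E (Finset.nonempty_def.2 ⟨t, ht⟩))
    (PMF.uniformOfFinset {t, t⁻¹} (by simp))

section lazyLampLaw

variable (B : Finset H) (hB : B.Nonempty) {ε : ℝ} (h0 : 0 < ε) (h1 : ε < 1)

theorem support_lazyLampLaw : (lazyLampLaw B hB ε h0 h1).support = (B : Set H) ∪ {1} := by
  rw [lazyLampLaw, PMF.support_mix h0 h1, PMF.support_uniformOfFinset, PMF.support_pure]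

theorem isSymmetric_lazyLampLaw (hBinv : ∀ h ∈ B, h⁻¹ ∈ B) :
    IsSymmetric (lazyLampLaw B hB ε h0 h1) := by
  classical
  refine isSymmetric_mix _ _ (isSymmetric_uniformOfFinset hB hBinv) fun g => ?_
  simp [PMF.pure_apply]

/-- As `1 ∉ B`, the trivial switch has mass exactly `1 - ε`; any other has at most `ε ≤ 1 - ε`. -/
theorem lazyLampLaw_le (hB1 : (1 : H) ∉ B) (hε : ε ≤ 1 / 2) (h : H) :
    lazyLampLaw B hB ε h0 h1 h ≤ ENNReal.ofReal (1 - ε) := by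
  classical
  rw [lazyLampLaw, PMF.mix_apply]
  by_cases hh : h = 1
  · rw [hh, PMF.uniformOfFinset_apply_of_notMem hB hB1]
    simp [PMF.pure_apply]
  · rw [PMF.pure_apply, if_neg hh, mul_zero, add_zero]
    calc _ ≤ ENNReal.ofReal ε * 1 := mul_le_mul_right (PMF.coe_le_one _ _) _
      _ ≤ _ := by
        rw [mul_one]
        exact ENNReal.ofReal_le_ofReal (by linarith)

theorem le_lazyLampLaw_one : ENNReal.ofReal (1 - ε) ≤ lazyLampLaw B hB ε h0 h1 1 := by
  classical
  rw [lazyLampLaw, PMF.mix_apply]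
  simp [PMF.pure_apply]

end lazyLampLaw

section biasedStepLaw

variable (E : Finset Q) {t : Q} (ht : t ∈ E) {ε : ℝ} (h0 : 0 < ε) (h1 : ε < 1)

theorem support_biasedStepLaw (hE : ∀ s ∈ E, s⁻¹ ∈ E) :
    (biasedStepLaw E t ht ε h0 h1).support = E := by
  classical
  rw [biasedStepLaw, PMF.support_mix h0 h1, PMF.support_uniformOfFinset,
    PMF.support_uniformOfFinset]
  refine Set.union_eq_left.2 ?_
  intro s hs
  rcases Finset.mem_insert.1 (Finset.mem_coe.1 hs) with rfl | hs
  · exact ht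
  · rw [Finset.mem_singleton.1 hs]
    exact hE t ht

theorem isSymmetric_biasedStepLaw (hE : ∀ s ∈ E, s⁻¹ ∈ E) :
    IsSymmetric (biasedStepLaw E t ht ε h0 h1) := by
  classical
  refine isSymmetric_mix _ _ (isSymmetric_uniformOfFinset _ hE)
    (isSymmetric_uniformOfFinset _ fun g hg => ?_)
  rcases Finset.mem_insert.1 hg with rfl | hg
  · simp
  · rw [Finset.mem_singleton.1 hg]
    simp

theorem le_biasedStepLaw : ENNReal.ofReal ((1 - ε) / 2) ≤ biasedStepLaw E t ht ε h0 h1 t := by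
  classical
  rw [biasedStepLaw, PMF.mix_apply]
  refine le_trans ?_ le_add_self
  rw [PMF.uniformOfFinset_apply_of_mem _ (by simp), ENNReal.ofReal_div_of_pos two_pos,
    ENNReal.div_eq_inv_mul, mul_comm]
  refine mul_le_mul_right ?_ _
  rw [ENNReal.ofReal_ofNat, ENNReal.inv_le_inv]
  exact_mod_cast Finset.card_le_two

end biasedStepLaw

/-- The switch-walk-switch law that does anything but a fair step by `t` or `t⁻¹` only rarely. -/
noncomputable def lazyLaw (B : Finset H) (hB : B.Nonempty) (E : Finset Q) (t : Q) (ht : t ∈ E)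
    (ε : ℝ) (h0 : 0 < ε) (h1 : ε < 1) : PMF (restrictedWreathProduct H Q) :=
  switchWalkSwitch (lazyLampLaw B hB ε h0 h1) (biasedStepLaw E t ht ε h0 h1)

theorem le_lazyLaw (B : Finset H) (hB : B.Nonempty) (E : Finset Q) (t : Q) (ht : t ∈ E)
    (ε : ℝ) (h0 : 0 < ε) (h1 : ε < 1) :
    ENNReal.ofReal ((1 - ε) ^ 3 / 2) ≤ lazyLaw B hB E t ht ε h0 h1 (move t) := by
  refine le_trans (le_of_eq ?_) (le_trans (mul_le_mul' (mul_le_mul'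
    (le_lazyLampLaw_one B hB h0 h1) (le_biasedStepLaw E ht h0 h1))
    (le_lazyLampLaw_one B hB h0 h1)) (le_switchWalkSwitch _ _ t))
  have := sub_pos.2 h1
  rw [← ENNReal.ofReal_mul this.le, ← ENNReal.ofReal_mul (by positivity)]
  congr 1
  ring

/-- Summability of `c ^ gap` for `c = 1/2`. -/
theorem pow_log_le (n : ℕ) :
    (1 / 2 : ℝ) ^ (2 * Nat.log 2 (n + 2)) ≤ 4 * (1 / ((n + 2 : ℕ) : ℝ) ^ 2) := by
  have h1 : ((n + 2 : ℕ) : ℝ) ≤ 2 ^ (Nat.log 2 (n + 2) + 1) := by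
    exact_mod_cast (Nat.lt_pow_succ_log_self one_lt_two (n + 2)).le
  set L := Nat.log 2 (n + 2)
  have h2 : (0 : ℝ) < (n + 2 : ℕ) := by positivity
  have h3 : ((n + 2 : ℕ) : ℝ) ^ 2 ≤ (2 ^ (L + 1)) ^ 2 := by gcongr
  rw [one_div_pow, mul_one_div, div_le_div_iff₀ (by positivity) (by positivity)]
  calc 1 * ((n + 2 : ℕ) : ℝ) ^ 2 ≤ (2 ^ (L + 1)) ^ 2 := by linarith
    _ = 4 * 2 ^ (2 * L) := by rw [← pow_mul, add_mul, pow_add, mul_comm L]; norm_num; ring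

/-- Divergence of the sum of `θ ^ gap` for `θ = 3/4`, because `(3/4)^2 = 9/16` exceeds `1/2`. -/
theorem le_pow_log (n : ℕ) : 1 / ((n + 2 : ℕ) : ℝ) ≤ (3 / 4 : ℝ) ^ (2 * Nat.log 2 (n + 2)) := by
  have h1 : (2 : ℝ) ^ Nat.log 2 (n + 2) ≤ (n + 2 : ℕ) := by
    exact_mod_cast Nat.pow_log_le_self 2 (by omega)
  calc 1 / ((n + 2 : ℕ) : ℝ) ≤ 1 / 2 ^ Nat.log 2 (n + 2) := by gcongr
    _ = (1 / 2) ^ Nat.log 2 (n + 2) := by rw [one_div_pow]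
    _ ≤ ((3 / 4) ^ 2) ^ Nat.log 2 (n + 2) := by gcongr; norm_num
    _ = _ := by rw [pow_mul]

theorem exists_unstable {lev : Q → ℤ} (hlev : ∀ x y, lev (x * y) = lev x + lev y)
    (B : Finset H) (hB : B.Nonempty) (hB1 : (1 : H) ∉ B) (hBinv : ∀ h ∈ B, h⁻¹ ∈ B)
    (E : Finset Q) (hE : ∀ s ∈ E, s⁻¹ ∈ E) (hElev : ∀ s ∈ E, |lev s| ≤ 1)
    (hEgen : Subgroup.closure (E : Set Q) = ⊤) {t : Q} (ht : t ∈ E) (ht1 : lev t = 1) :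
    ∃ μ ν : PMF (restrictedWreathProduct H Q),
      (IsSymmetric μ ∧ μ.support.Finite) ∧ (IsSymmetric ν ∧ ν.support.Finite) ∧
      Subgroup.closure μ.support = Subgroup.closure ν.support ∧
      (Subgroup.closure (B : Set H) = ⊤ → Subgroup.closure μ.support = ⊤) ∧
      RecurrenceUnstable μ ν ∧ GreenUnstable μ ν := by
  classical
  have lev_one : lev 1 = 0 := by simpa using hlev 1 1
  let F : ∀ ε : ℝ, 0 < ε → ε < 1 → PMF (restrictedWreathProduct H Q) :=
    fun ε h0 h1 => lazyLaw B hB E t ht ε h0 h1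
  have hsym : ∀ ε h0 h1, IsSymmetric (F ε h0 h1) := fun ε h0 h1 =>
    isSymmetric_switchWalkSwitch (isSymmetric_lazyLampLaw B hB h0 h1 hBinv)
      (isSymmetric_biasedStepLaw E ht h0 h1 hE)
  have hfin : ∀ ε h0 h1, (F ε h0 h1).support.Finite := fun ε h0 h1 =>
    finite_support_switchWalkSwitch
      (by rw [support_lazyLampLaw]; exact B.finite_toSet.union (Set.finite_singleton 1))
      (by rw [support_biasedStepLaw E ht h0 h1 hE]; exact E.finite_toSet)
  have hρ : ∀ ε h0 h1, ∀ s ∈ (biasedStepLaw E t ht ε h0 h1).support, |lev s| ≤ 1 := by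
    intro ε h0 h1 s hs
    rw [support_biasedStepLaw E ht h0 h1 hE] at hs
    exact hElev s hs
  have hF : ∀ ε h0 h1, ENNReal.ofReal ((1 - ε) ^ 3 / 2) ≤ F ε h0 h1 (move t) := fun ε h0 h1 =>
    le_lazyLaw B hB E t ht ε h0 h1
  have hF' : ∀ ε h0 h1, ENNReal.ofReal ((1 - ε) ^ 3 / 2) ≤ F ε h0 h1 (move t)⁻¹ :=
    fun ε h0 h1 => by rw [hsym]; exact hF ε h0 h1
  have htmem : ∀ ε h0 h1, move t ∈ (F ε h0 h1).support := by
    intro ε h0 h1 h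
    have h2 := hF ε h0 h1
    rw [h, nonpos_iff_eq_zero, ENNReal.ofReal_eq_zero] at h2
    have h3 := sub_pos.2 h1
    have : 0 < (1 - ε) ^ 3 / 2 := by positivity
    linarith
  have htord : ∀ z : ℤ, (move t : restrictedWreathProduct H Q) ^ z = 1 → z = 0 := by
    intro z hz
    have h1 : t ^ z = 1 := by
      have := congrArg site hz
      rwa [← map_zpow, site_move, site_one] at this
    have h2 := congrArg (MonoidHom.mk' (fun x => Multiplicative.ofAdd (lev x)) fun x y => by
      rw [hlev, ofAdd_add]) h1
    rw [map_zpow, map_one] at h2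
    simpa [ht1] using congrArg Multiplicative.toAdd h2
  -- This places `t ^ n` in a cleared set, so the bound on visits also bounds Green's function
  -- there.
  have hmem : ∀ n : ℕ, (move t : restrictedWreathProduct H Q) ^ n ∈ clearedSet H lev 0 n := by
    intro n
    rw [← map_pow]
    refine ⟨?_, fun x _ => by rw [lamps_move, Pi.one_apply]⟩
    rw [site_move]
    induction n with
    | zero => simp [lev_one]
    | succ n ih => rw [pow_succ, hlev, ih, ht1]; simp
  have hupper : ∀ ε h0 h1, ε ≤ 1 / 2 → ∃ C : ENNReal, C ≠ ⊤ ∧ ∀ n : ℕ,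
      green (F ε h0 h1) 1 (move t ^ n) ≤ C * ENNReal.ofReal (1 - ε) ^ n := by
    intro ε h0 h1 hε
    obtain ⟨C, hC, h⟩ := exists_tsum_clearedSet_le hlev
      (by rw [← ENNReal.ofReal_one, ENNReal.ofReal_lt_ofReal_iff one_pos]; linarith)
      (lazyLampLaw_le B hB h0 h1 hB1 hε) (hρ ε h0 h1) (hsym ε h0 h1) (htmem ε h0 h1)
      (by simpa using ht1)
    exact ⟨C, hC, fun n => (green_one_le_of_mem _ (hmem n)).trans (h 0 n (Nat.zero_le n))⟩
  have hlower : ∀ ε h0 h1, ∀ b θ : ℝ, 0 ≤ b → b < 1 / 2 → b ≤ (1 - ε) ^ 3 / 2 → 0 ≤ θ → θ ≤ 1 →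
      θ ≤ b * (1 + θ ^ 2) → ∀ n : ℕ,
      ENNReal.ofReal θ ^ n ≤ green (F ε h0 h1) 1 (move t ^ n) := by
    intro ε h0 h1 b θ hb hb' hbε hθ hθ' hθb n
    refine pow_le_green _ htord ((ENNReal.ofReal_le_ofReal hbε).trans (hF ε h0 h1))
      ((ENNReal.ofReal_le_ofReal hbε).trans (hF' ε h0 h1)) ?_ ?_ ?_ n
    · rw [← ENNReal.ofReal_ofNat, ← ENNReal.ofReal_mul two_pos.le, ← ENNReal.ofReal_one,
        ENNReal.ofReal_lt_ofReal_iff one_pos]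
      linarith
    · rw [← ENNReal.ofReal_one]
      exact ENNReal.ofReal_le_ofReal hθ'
    · rw [← ENNReal.ofReal_one, ← ENNReal.ofReal_pow hθ, ← ENNReal.ofReal_add zero_le_one
        (by positivity), ← ENNReal.ofReal_mul hb]
      exact ENNReal.ofReal_le_ofReal hθb
  have e0 : (0 : ℝ) < 1 / 2 := by norm_num
  have e1 : (1 / 2 : ℝ) < 1 := by norm_num
  have d0 : (0 : ℝ) < 1 / 100 := by norm_num
  have d1 : (1 / 100 : ℝ) < 1 := by norm_num
  have hsupp : (F (1 / 2) e0 e1).support = (F (1 / 100) d0 d1).support :=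
    support_switchWalkSwitch_congr (by rw [support_lazyLampLaw, support_lazyLampLaw])
      (by rw [support_biasedStepLaw E ht _ _ hE, support_biasedStepLaw E ht _ _ hE])
  -- For `ε = 1/2`, `c = 1/2`. For `ε = 1/100`, `b = 12/25` is below `(99/100)^3 / 2`, and `θ = 3/4`
  -- solves `θ = b * (1 + θ ^ 2)` exactly.
  refine ⟨F (1 / 2) e0 e1, F (1 / 100) d0 d1, ⟨hsym _ _ _, hfin _ _ _⟩, ⟨hsym _ _ _, hfin _ _ _⟩,
    by rw [hsupp], fun hgen => ?_, ?_, ?_⟩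
  · refine closure_support_switchWalkSwitch ?_ ?_ ?_
    · rw [support_lazyLampLaw]
      exact Or.inr rfl
    · rw [support_lazyLampLaw, Subgroup.closure_union, hgen, top_sup_eq]
    · rw [support_biasedStepLaw E ht _ _ hE, hEgen]
  · let A : ℕ → ℕ := fun j => ∑ i ∈ Finset.range j, 2 * Nat.log 2 (i + 2)
    have hAsub : ∀ j, A (j + 1) - A j = 2 * Nat.log 2 (j + 2) := fun j => by
      simp only [A, Finset.sum_range_succ, Nat.add_sub_cancel_left]
    have hA : StrictMono A := strictMono_nat_of_lt_succ fun j => by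
      have : 0 < Nat.log 2 (j + 2) := Nat.log_pos one_lt_two (by omega)
      simp only [A, Finset.sum_range_succ]
      omega
    refine ⟨⋃ j, clearedSet H lev (A j) (A (j + 1)), ?_, ?_⟩
    · refine isRecurrentSet_iUnion_clearedSet hlev (hρ _ _ _) (hsym _ _ _) (hfin _ _ _) ht1
        (b := 12 / 25) (θ := 3 / 4) (by norm_num) ?_ (by norm_num) (by norm_num) (by norm_num)
        hA ?_
      · rw [← ENNReal.ofReal_le_iff_le_toReal (PMF.apply_ne_top _ _)]
        exact (ENNReal.ofReal_le_ofReal (by norm_num)).trans (hF _ d0 d1)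
      · simp_rw [hAsub]
        intro h
        refine Real.not_summable_one_div_natCast ((summable_nat_add_iff 2).1
          (Summable.of_nonneg_of_le (fun n => by positivity) le_pow_log h))
    · refine isTransientSet_iUnion_clearedSet hlev (c := ENNReal.ofReal (1 - 1 / 2))
        (by rw [← ENNReal.ofReal_one, ENNReal.ofReal_lt_ofReal_iff one_pos]; norm_num)
        (lazyLampLaw_le B hB e0 e1 hB1 le_rfl) (hρ _ _ _) (hsym _ _ _) (hfin _ _ _)
        (htmem _ _ _) (by simpa using ht1) hA.monotone ?_
      simp_rw [hAsub, ← ENNReal.ofReal_pow (by norm_num : (0 : ℝ) ≤ 1 - 1 / 2)]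
      have hs : Summable fun j => (1 - 1 / 2 : ℝ) ^ (2 * Nat.log 2 (j + 2)) := by
        rw [show (1 - 1 / 2 : ℝ) = 1 / 2 by norm_num]
        refine Summable.of_nonneg_of_le (fun n => by positivity) pow_log_le (Summable.mul_left 4 ?_)
        exact (summable_nat_add_iff (f := fun n : ℕ => 1 / (n : ℝ) ^ 2) 2).2
          (Real.summable_one_div_nat_pow.2 one_lt_two)
      rw [← ENNReal.ofReal_tsum_of_nonneg (fun n => by positivity) hs]
      exact ENNReal.ofReal_ne_top
  · obtain ⟨C, hC, hμu⟩ := hupper _ e0 e1 le_rfl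
    obtain ⟨C', hC', hνu⟩ := hupper _ d0 d1 (by norm_num)
    -- Only positivity of `μ`'s Green's function is needed, so this bound is crude; `1/16 = (1/2)^3
    -- / 2`.
    have hμl := hlower _ e0 e1 (1 / 16) (1 / 16) (by norm_num) (by norm_num) (by norm_num)
      (by norm_num) (by norm_num) (by norm_num)
    have hνl := hlower _ d0 d1 (12 / 25) (3 / 4) (by norm_num) (by norm_num) (by norm_num)
      (by norm_num) (by norm_num) (by norm_num)
    have hpos : ∀ (θ : ℝ) (n : ℕ), 0 < θ → 0 < ENNReal.ofReal θ ^ n := fun θ n h =>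
      ENNReal.pow_pos (ENNReal.ofReal_pos.2 h) n
    have htop : ∀ (C : ENNReal) (θ : ℝ) (n : ℕ), C ≠ ⊤ → C * ENNReal.ofReal θ ^ n < ⊤ :=
      fun C θ n h => ENNReal.mul_lt_top h.lt_top (ENNReal.pow_lt_top ENNReal.ofReal_lt_top)
    refine ⟨fun n => move t ^ n, fun n => ⟨(hpos _ n (by norm_num)).trans_le (hμl n),
      (hμu n).trans_lt (htop _ _ _ hC), (hpos _ n (by norm_num)).trans_le (hνl n),
      (hνu n).trans_lt (htop _ _ _ hC')⟩, ?_⟩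
    -- The ratio `2/3` is `c / θ = (1/2) / (3/4)`.
    have hle : ∀ n : ℕ, green (F (1 / 2) e0 e1) 1 (move t ^ n) /
        green (F (1 / 100) d0 d1) 1 (move t ^ n) ≤ C * ENNReal.ofReal (2 / 3) ^ n := by
      intro n
      refine (ENNReal.div_le_div (hμu n) (hνl n)).trans (le_of_eq ?_)
      rw [mul_div_assoc]
      congr 1
      rw [← ENNReal.ofReal_pow (by norm_num), ← ENNReal.ofReal_pow (by norm_num),
        ← ENNReal.ofReal_pow (by norm_num), ← ENNReal.ofReal_div_of_pos (by positivity),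
        ← div_pow]
      norm_num
    refine tendsto_of_tendsto_of_tendsto_of_le_of_le tendsto_const_nhds ?_ (fun n => bot_le) hle
    have hlt : ENNReal.ofReal (2 / 3) < 1 := by
      rw [← ENNReal.ofReal_one, ENNReal.ofReal_lt_ofReal_iff one_pos]
      norm_num
    simpa using ENNReal.Tendsto.const_mul
      (ENNReal.tendsto_pow_atTop_nhds_zero_of_lt_one hlt) (Or.inr hC)

/-! ### Specialization to `H ≀ ℤ^d` -/

/-- Adjoining a nontrivial element keeps `B` nonempty even if `H` is not finitely generated, and
removing 1 costs nothing for generation. -/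
theorem exists_symmetric_generators (H : Type*) [Group H] [Nontrivial H] :
    ∃ B : Finset H, B.Nonempty ∧ (1 : H) ∉ B ∧ (∀ h ∈ B, h⁻¹ ∈ B) ∧
      (Group.FG H → Subgroup.closure (B : Set H) = ⊤) := by
  classical
  obtain ⟨S, hS⟩ : ∃ S : Finset H, Group.FG H → Subgroup.closure (S : Set H) = ⊤ := by
    by_cases h : Group.FG H
    · obtain ⟨S, hS⟩ := Group.fg_def.1 h
      exact ⟨S, fun _ => hS⟩
    · exact ⟨∅, fun h' => absurd h' h⟩
  obtain ⟨h₀, hh₀⟩ := exists_ne (1 : H)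
  set T := insert h₀ S
  refine ⟨(T ∪ T.image (·⁻¹)).erase 1, ⟨h₀, by simp [T, hh₀]⟩, by simp, fun h hh => ?_,
    fun hfg => ?_⟩
  · simp only [Finset.mem_erase, Finset.mem_union, Finset.mem_image] at hh ⊢
    refine ⟨inv_ne_one.2 hh.1, ?_⟩
    rcases hh.2 with h1 | ⟨g, hg, rfl⟩
    · exact Or.inr ⟨h, h1, rfl⟩
    · exact Or.inl (by simpa using hg)
  · rw [eq_top_iff, ← hS hfg, Subgroup.closure_le]
    intro s hs
    by_cases h1 : s = 1
    · rw [h1]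
      exact Subgroup.one_mem _
    · exact Subgroup.subset_closure (by simp [T, h1, Finset.mem_coe.1 hs])

end RandomWalk

theorem theorem2 (H : Type*) [Group H] [Nontrivial H] (d : ℕ) (hd : 1 ≤ d) :
    ∃ μ ν : PMF (LamplighterGroup H d),
      (RandomWalk.IsSymmetric μ ∧ μ.support.Finite) ∧
      (RandomWalk.IsSymmetric ν ∧ ν.support.Finite) ∧
      Subgroup.closure μ.support = Subgroup.closure ν.support ∧
      (Group.FG H → Subgroup.closure μ.support = ⊤) ∧
      RandomWalk.RecurrenceUnstable μ ν ∧
      RandomWalk.GreenUnstable μ ν := by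
  classical
  obtain ⟨B, hB, hB1, hBinv, hBgen⟩ := RandomWalk.exists_symmetric_generators H
  let i₀ : Fin d := ⟨0, hd⟩
  let e : Fin d → Multiplicative (Fin d → ℤ) := fun i => Multiplicative.ofAdd (Pi.single i 1)
  let E : Finset (Multiplicative (Fin d → ℤ)) :=
    Finset.univ.image e ∪ Finset.univ.image fun i => (e i)⁻¹
  have hEmem : ∀ s, s ∈ E ↔ ∃ i, e i = s ∨ (e i)⁻¹ = s := fun s => by
    simp [E, exists_or]
  have he : ∀ i, (Multiplicative.toAdd (e i)) i₀ = if i₀ = i then 1 else 0 := fun i => by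
    simp [e, Pi.single_apply]
  obtain ⟨μ, ν, h1, h2, h3, h4, h5⟩ := RandomWalk.exists_unstable (H := H)
    (lev := fun x : Multiplicative (Fin d → ℤ) => Multiplicative.toAdd x i₀)
    (fun x y => by simp) B hB hB1 hBinv E
    (fun s hs => by
      obtain ⟨i, rfl | rfl⟩ := (hEmem s).1 hs
      · exact (hEmem _).2 ⟨i, Or.inr rfl⟩
      · exact (hEmem _).2 ⟨i, Or.inl (inv_inv _).symm⟩)
    (fun s hs => by
      obtain ⟨i, rfl | rfl⟩ := (hEmem s).1 hs
      · rw [he]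
        split_ifs <;> simp
      · rw [toAdd_inv, Pi.neg_apply, he]
        split_ifs <;> simp)
    (by
      refine (Subgroup.eq_top_iff' _).2 fun y => ?_
      have hy : y = ∏ i, e i ^ (Multiplicative.toAdd y i) := by
        apply Multiplicative.toAdd.injective
        ext j
        simp [e, toAdd_prod, Finset.sum_apply, Pi.single_apply]
      rw [hy]
      exact Subgroup.prod_mem _ fun i _ => Subgroup.zpow_mem _
        (Subgroup.subset_closure ((hEmem _).2 ⟨i, Or.inl rfl⟩)) _)
    (t := e i₀) ((hEmem _).2 ⟨i₀, Or.inl rfl⟩) (by simp [he])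
  exact ⟨μ, ν, h1, h2, h3, fun h => h4 (hBgen h), h5⟩
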